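/- Let $N\in\mathbb N$, let $(e_n)_{n=1}^N$ be an orthonormal basis of $\mathbb R^N$, and let $A$ and $Q$ be the linear operators on $\mathbb R^N$ with $Ae_n=-\lambda_n e_n$ and $Qe_n=\sigma_n^2e_n$, where $\lambda_n>0$ and $\sigma_n\ge 0$ for $n=1,\dots,N$; let $\sqrt Q\,e_n=\sigma_ne_n$. Let $\beta^1,\dots,\beta^N$ be independent real Brownian motions on a probability space $(\Omega,\mathcal F,\mathbb P)$ and $W^N=\sum_{n=1}^N\beta^ne_n$. Let $\ell\colon[0,\infty)\to[0,\infty)$ be a (deterministic) increasing, not necessarily strictly increasing, càdlàg function with $\ell_0=0$ and $\ell_t>0$ for $t>0$. All integrals from $0$ to $t$ with respect to $d\ell_s$ and $d\beta^n_{\ell_s}$ are over $(0,t]$; the stochastic integral $\int_0^tf(s)\,d\beta^n_{\ell_s}$ of a continuous deterministic $f$ is the limit in probability of the sums $\sum_i f(u_i)(\beta^n_{\ell_{u_{i+1}}}-\beta^n_{\ell_{u_i}})$ as the mesh of the partition $0=u_0\le\dots\le u_m=t$ tends to $0$. For every $x\in\mathbb R^N$ the linear SDE $$dZ^\ell_t(x)=AZ^\ell_t(x)\,dt+\sqrt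 Q\,dW^N_{\ell_t},\qquad Z^\ell_0(x)=x,$$ has a càdlàg solution, unique up to indistinguishability, and the stochastic integrals $\int_0^te^{-\lambda_n(t-s)}d\beta^n_{\ell_s}$ exist. For all $t\ge0$ and $x\in\mathbb R^N$, $$Z^\ell_t(x)=e^{tA}x+\int_0^te^{(t-s)A}\sqrt Q\,dW^N_{\ell_s}=e^{tA}x+\sum_{n=1}^N\sigma_n\Big(\int_0^te^{-\lambda_n(t-s)}d\beta^n_{\ell_s}\Big)e_n\quad\mathbb P\text{-a.s.},$$ and $$Z^\ell_t(x)\sim\mathcal N\Big(e^{tA}x,\int_0^te^{2A(t-s)}Q\,d\ell_s\Big),$$ the covariance integral being taken entrywise. Suppose moreover that $\sigma_n>0$ for $n=1,\dots,N$. Then for every $t>0$ and every bounded Borel function $\phi\colon\mathbb R^N\to\mathbb R$, the function $x\mapsto\mathbb E[\phi(Z^\ell_t(x))]$ is differentiable at every $x\in\mathbb R^N$, and for every $h\in\mathbb R^N$ $$\big\langle\nabla\mathbb E[\phi(Z^\ell_t(x))],h\big\rangle=\mathbb E\left[\phi(Z^\ell_t(x))\left(\sum_{n=1}^N\frac1{\sigma_n}\,\frac{e^{-\lambda_nt}\langle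 h,e_n\rangle}{\int_0^te^{-2\lambda_n(t-s)}d\ell_s}\int_0^te^{-\lambda_n(t-s)}d\beta^n_{\ell_s}\right)\right],$$ where the random variable on the right is integrable. -/

import Mathlib

open MeasureTheory ProbabilityTheory Set Filter
open scoped NNReal ENNReal Topology

noncomputable section

/-- Right-continuous with left limits at every time of `[0, ∞)`
(the left-limit condition at time `0` is void, since `𝓝[<] 0 = ⊥` in `ℝ≥0`). -/
def IsCadlag {F : Type*} [TopologicalSpace F] (f : ℝ≥0 → F) : Prop :=
  ∀ t, ContinuousWithinAt f (Ici t) t ∧ ∃ y, Tendsto f (𝓝[<] t) (𝓝 y)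

/-- Deterministic time changes: increasing (not necessarily strictly) càdlàg functions
`ℓ : [0, ∞) → [0, ∞)` with `ℓ 0 = 0` and `ℓ t > 0` for `t > 0`. -/
structure TimeChange where
  toFun : ℝ≥0 → ℝ≥0
  monotone' : Monotone toFun
  cadlag' : IsCadlag toFun
  map_zero' : toFun 0 = 0
  pos' : ∀ t, 0 < t → 0 < toFun t

instance : CoeFun TimeChange (fun _ => ℝ≥0 → ℝ≥0) := ⟨TimeChange.toFun⟩

/-- A time change as a Stieltjes function on `[0, ∞)`. -/
def TimeChange.stieltjes (ℓ : TimeChange) : StieltjesFunction ℝ≥0 where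
  toFun t := (ℓ t : ℝ)
  mono' := fun _ _ h => NNReal.coe_le_coe.2 (ℓ.monotone' h)
  right_continuous' := fun t =>
    NNReal.continuous_coe.continuousAt.comp_continuousWithinAt (ℓ.cadlag' t).1

/-- The Lebesgue-Stieltjes integral `∫_0^t g(s) dℓ_s`, over `(0, t]`. -/
def TimeChange.integral (ℓ : TimeChange) (g : ℝ≥0 → ℝ) (t : ℝ≥0) : ℝ :=
  ∫ s in Ioc 0 t, g s ∂ℓ.stieltjes.measure

/-- `X = (X_t)` is a càdlàg solution of `dX_t = A X_t dt + S dY_t`, `X_0 = x`, where the noise `Y`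
is additive: almost surely, the path is càdlàg and satisfies
`X_t = x + ∫_0^t A X_s ds + S (Y_t - Y_0)` for all `t ≥ 0`. -/
def IsOUSolution {Ω : Type*} [MeasurableSpace Ω] {N : ℕ} (P : Measure Ω)
    (A S : EuclideanSpace ℝ (Fin N) →L[ℝ] EuclideanSpace ℝ (Fin N))
    (Y : ℝ≥0 → Ω → EuclideanSpace ℝ (Fin N)) (x : EuclideanSpace ℝ (Fin N))
    (X : ℝ≥0 → Ω → EuclideanSpace ℝ (Fin N)) : Prop :=
  ∀ᵐ ω ∂P, IsCadlag (fun t => X t ω) ∧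
    ∀ t : ℝ≥0, X t ω = x + (∫ s in (0 : ℝ)..t, A (X s.toNNReal ω)) + S (Y t ω - Y 0 ω)

/-- `I` is the stochastic integral `∫_0^t f(s) dY_s` of the deterministic integrand `f` against the
càdlàg process `Y`: the left-point sums `∑ f(u_i) (Y_{u_{i+1}} - Y_{u_i})` converge to `I` in
probability as the mesh of the partition `0 = u_0 ≤ ⋯ ≤ u_m = t` tends to `0`. -/
def IsStochIntegral {Ω : Type*} [MeasurableSpace Ω] (P : Measure Ω)
    (f : ℝ≥0 → ℝ) (Y : ℝ≥0 → Ω → ℝ) (t : ℝ≥0) (I : Ω → ℝ) : Prop :=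
  AEMeasurable I P ∧
    ∀ ε : ℝ, 0 < ε → ∃ δ : ℝ, 0 < δ ∧ ∀ (m : ℕ) (u : ℕ → ℝ≥0),
      Monotone u → u 0 = 0 → u m = t → (∀ i < m, (u (i + 1) : ℝ) - u i ≤ δ) →
        P {ω | ε ≤ |(∑ i ∈ Finset.range m, f (u i) * (Y (u (i + 1)) ω - Y (u i) ω)) - I ω|}
          ≤ ENNReal.ofReal ε

open Classical in
/-- The stochastic integral `∫_0^t f(s) dY_s` (a version of it, as it is unique up to
almost sure equality); zero if the integral does not exist. -/
def stochIntegral {Ω : Type*} [MeasurableSpace Ω] (P : Measure Ω)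
    (f : ℝ≥0 → ℝ) (Y : ℝ≥0 → Ω → ℝ) (t : ℝ≥0) : Ω → ℝ :=
  if h : ∃ I, IsStochIntegral P f Y t I then h.choose else 0

/-- The covariance matrix `∫_0^t e^{2 (t - s) A} Q dℓ_s`, the integral being taken entrywise. -/
def ouCovariance {N : ℕ} (A Q : EuclideanSpace ℝ (Fin N) →L[ℝ] EuclideanSpace ℝ (Fin N))
    (ℓ : TimeChange) (t : ℝ≥0) : Matrix (Fin N) (Fin N) ℝ :=
  Matrix.of fun i j => ℓ.integral (fun s =>
    (Matrix.toEuclideanCLM (n := Fin N) (𝕜 := ℝ)).symm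
      (NormedSpace.exp ((2 * ((t : ℝ) - s)) • A) * Q) i j) t

end

/-! ### Càdlàg paths -/

/-! In the eigenbasis the equation splits into scalar equations `z t = x - lam * ∫ z + g t`, where
`g` is a multiple of a time-changed Brownian path and hence almost surely càdlàg. The noise is
additive, so each is solved path by path: the continuous part `z - g` has right derivative `-lam *
z`, and an integrating factor gives the explicit solution `ouPath` and its uniqueness (`ouPath_eq`,
`eq_ouPath_of_forall_eq`).

Since the integrand `exp (-lam * (t - s))` is smooth, summation by parts makes the left-point sums
converge pathwise to `ouPath lam 0` (`IsPartitionSeq.tendsto_sum_exp_mul_sub`). Thus the stochastic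
integral exists, equals this functional almost surely, and yields variation of constants without Itô
theory.

The left-point sums are centred Gaussian, with variances that are Stieltjes sums of the squared
integrand; limits give the law of each integral, and independence of the Brownian motions gives a
product law (`hasLaw_pi_ouPath`). The solution is an affine image of it.

For the gradient, moving the starting point translates the Gaussian coordinates. The Cameron-Martin
formula moves this translation from `φ` to a smooth density, so a bounded Borel `φ` suffices;
differentiating the density at zero shift produces the weight `y i / v i`. The variances `v i` are
positive because `ℓ t > 0`. -/

lemma IsCadlag.comp_continuous {F G : Type*} [TopologicalSpace F] [TopologicalSpace G]
    {f : ℝ≥0 → F} (hf : IsCadlag f) {g : F → G} (hg : Continuous g) :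
    IsCadlag (fun t => g (f t)) := fun t =>
  ⟨hg.continuousAt.comp_continuousWithinAt (hf t).1,
    let ⟨y, hy⟩ := (hf t).2; ⟨g y, (hg.tendsto y).comp hy⟩⟩

lemma Continuous.isCadlag {F : Type*} [TopologicalSpace F] {f : ℝ≥0 → F} (hf : Continuous f) :
    IsCadlag f := fun t =>
  ⟨hf.continuousWithinAt, f t, (hf.tendsto t).mono_left nhdsWithin_le_nhds⟩

lemma IsCadlag.add {F : Type*} [TopologicalSpace F] [Add F] [ContinuousAdd F] {f g : ℝ≥0 → F}
    (hf : IsCadlag f) (hg : IsCadlag g) : IsCadlag (fun t => f t + g t) := fun t =>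
  ⟨(hf t).1.add (hg t).1,
    let ⟨y, hy⟩ := (hf t).2; let ⟨z, hz⟩ := (hg t).2; ⟨y + z, hy.add hz⟩⟩

lemma IsCadlag.sum {F ι : Type*} [TopologicalSpace F] [AddCommMonoid F] [ContinuousAdd F]
    {f : ι → ℝ≥0 → F} (s : Finset ι) (hf : ∀ i ∈ s, IsCadlag (f i)) :
    IsCadlag (fun t => ∑ i ∈ s, f i t) := fun t => by
  refine ⟨tendsto_finsetSum _ fun i hi => (hf i hi t).1, ?_⟩
  choose! y hy using fun i hi => (hf i hi t).2
  exact ⟨∑ i ∈ s, y i, tendsto_finsetSum _ fun i hi => hy i hi⟩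

/-- A càdlàg path is bounded on compact time intervals. -/
lemma IsCadlag.exists_norm_le {F : Type*} [SeminormedAddCommGroup F] {f : ℝ≥0 → F}
    (hf : IsCadlag f) (T : ℝ≥0) : ∃ C : ℝ, ∀ s ≤ T, ‖f s‖ ≤ C := by
  have key : ∃ C : ℝ, ∀ s ∈ Icc 0 T, ‖f s‖ ≤ C := by
    -- Boundedness passes to subsets and finite unions, so a bound near each point is enough: the
    -- left limit controls one side, right continuity the other.
    refine isCompact_Icc.induction_on (p := fun S => ∃ C : ℝ, ∀ s ∈ S, ‖f s‖ ≤ C)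
      ⟨0, by simp⟩ (fun S S' h ⟨C, hC⟩ => ⟨C, fun s hs => hC s (h hs)⟩) ?_ ?_
    · rintro S S' ⟨C, hC⟩ ⟨C', hC'⟩
      refine ⟨max C C', fun s hs => ?_⟩
      rcases hs with hs | hs
      · exact (hC s hs).trans (le_max_left _ _)
      · exact (hC' s hs).trans (le_max_right _ _)
    · intro t _
      obtain ⟨y, hy⟩ := (hf t).2
      have h1 : ∀ᶠ s in 𝓝[<] t, ‖f s‖ < ‖y‖ + 1 := hy.norm.eventually_lt_const (by linarith)
      have h2 : ∀ᶠ s in 𝓝[≥] t, ‖f s‖ < ‖f t‖ + 1 :=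
        (hf t).1.norm.eventually_lt_const (by linarith)
      have h3 : ∀ᶠ s in 𝓝 t, ‖f s‖ ≤ max (‖y‖ + 1) (‖f t‖ + 1) := by
        rw [← nhdsLT_sup_nhdsGE t, eventually_sup]
        exact ⟨h1.mono fun s hs => hs.le.trans (le_max_left _ _),
          h2.mono fun s hs => hs.le.trans (le_max_right _ _)⟩
      exact ⟨_, mem_nhdsWithin_of_mem_nhds h3, _, fun s hs => hs⟩
  obtain ⟨C, hC⟩ := key
  exact ⟨C, fun s hs => hC s ⟨zero_le, hs⟩⟩

/-- A càdlàg path is Borel measurable. -/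
lemma IsCadlag.measurable {F : Type*} [TopologicalSpace F] [TopologicalSpace.PseudoMetrizableSpace F]
    [MeasurableSpace F] [BorelSpace F] {f : ℝ≥0 → F} (hf : IsCadlag f) : Measurable f := by
  -- Grid points to the right of `s`, within `1 / (n + 1)`. Each `f ∘ c n` factors through the floor
  -- function, so it is measurable, and right continuity gives convergence to `f`.
  let c : ℕ → ℝ≥0 → ℝ≥0 := fun n s => (⌊s * (n + 1)⌋₊ + 1 : ℝ≥0) / (n + 1)
  have hc1 : ∀ n s, s ≤ c n s := fun n s => by
    rw [le_div_iff₀ (by positivity)]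
    exact (Nat.lt_floor_add_one _).le
  have hc2 : ∀ n s, c n s ≤ s + 1 / (n + 1) := fun n s => by
    rw [div_le_iff₀ (by positivity), add_mul, one_div, inv_mul_cancel₀ (by positivity)]
    gcongr
    exact Nat.floor_le zero_le
  have hc3 : ∀ s, Tendsto (fun n => c n s) atTop (𝓝[≥] s) := fun s => by
    refine tendsto_nhdsWithin_iff.2 ⟨?_, Eventually.of_forall fun n => hc1 n s⟩
    refine tendsto_of_tendsto_of_tendsto_of_le_of_le tendsto_const_nhds ?_
      (fun n => hc1 n s) (fun n => hc2 n s)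
    have : Tendsto (fun n : ℕ => (1 : ℝ≥0) / ((n : ℝ≥0) + 1)) atTop (𝓝 0) :=
      tendsto_one_div_add_atTop_nhds_zero_nat
    simpa using this.const_add s
  refine measurable_of_tendsto_metrizable (f := fun n s => f (c n s)) (fun n => ?_)
    (tendsto_pi_nhds.2 fun s => (hf s).1.tendsto.comp (hc3 s))
  have : (fun s => f (c n s)) =
      (fun k : ℕ => f ((k + 1 : ℝ≥0) / (n + 1))) ∘ fun s : ℝ≥0 => ⌊s * (n + 1)⌋₊ := rfl
  rw [this]
  exact measurable_from_top.comp (Nat.measurable_floor.comp (by fun_prop))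

lemma IsCadlag.intervalIntegrable {F : Type*} [NormedAddCommGroup F] [MeasurableSpace F]
    [BorelSpace F] [SecondCountableTopology F] {f : ℝ≥0 → F} (hf : IsCadlag f) (a b : ℝ) :
    IntervalIntegrable (fun s => f s.toNNReal) volume a b := by
  obtain ⟨C, hC⟩ := hf.exists_norm_le (max a b).toNNReal
  refine (intervalIntegrable_const (c := C)).mono_fun
    (hf.measurable.comp measurable_real_toNNReal).aestronglyMeasurable ?_
  refine (ae_restrict_iff' measurableSet_uIoc).2 (Eventually.of_forall fun s hs => ?_)
  exact (hC _ (Real.toNNReal_le_toNNReal hs.2)).trans (le_abs_self C)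

lemma IsCadlag.continuousWithinAt_toNNReal {F : Type*} [TopologicalSpace F] {f : ℝ≥0 → F}
    (hf : IsCadlag f) (s : ℝ) : ContinuousWithinAt (fun s : ℝ => f s.toNNReal) (Ici s) s :=
  (hf s.toNNReal).1.comp continuous_real_toNNReal.continuousWithinAt
    fun _ h => Real.toNNReal_le_toNNReal h

/-! ### The scalar linear equation driven by a càdlàg path -/

/-- The solution of `z t = x - lam * ∫ s in 0..t, z s + g t`. -/
noncomputable def ouPath (lam x : ℝ) (g : ℝ≥0 → ℝ) (t : ℝ≥0) : ℝ :=
  Real.exp (-lam * t) * (x - lam * ∫ s in (0 : ℝ)..t, Real.exp (lam * s) * g s.toNNReal) + g t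

section Scalar

variable {lam x : ℝ} {g : ℝ≥0 → ℝ}

lemma IsCadlag.intervalIntegrable_exp_mul (hg : IsCadlag g) (lam a b : ℝ) :
    IntervalIntegrable (fun s => Real.exp (lam * s) * g s.toNNReal) volume a b :=
  (hg.intervalIntegrable a b).continuousOn_mul (by fun_prop)

/-- Only the derivative from the right is available, since `g` may jump; the fundamental theorem of
calculus is therefore used in its right-derivative form. -/
lemma IsCadlag.hasDerivWithinAt_integral_exp_mul (hg : IsCadlag g) (lam t : ℝ) :
    HasDerivWithinAt (fun t => ∫ s in (0 : ℝ)..t, Real.exp (lam * s) * g s.toNNReal)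
      (Real.exp (lam * t) * g t.toNNReal) (Ioi t) t := by
  refine (intervalIntegral.integral_hasDerivWithinAt_right
    (hg.intervalIntegrable_exp_mul lam 0 t) (s := Ici t) (t := Ioi t) ?_ ?_).mono Ioi_subset_Ici_self
  · have h : Measurable fun s : ℝ => Real.exp (lam * s) * g s.toNNReal :=
      Measurable.mul (by fun_prop) (hg.measurable.comp measurable_real_toNNReal)
    exact h.stronglyMeasurable.stronglyMeasurableAtFilter
  · exact ContinuousWithinAt.mul (by fun_prop)
      ((hg.continuousWithinAt_toNNReal t).mono Ioi_subset_Ici_self)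

lemma IsCadlag.continuous_integral_exp_mul (hg : IsCadlag g) (lam : ℝ) :
    Continuous (fun t => ∫ s in (0 : ℝ)..t, Real.exp (lam * s) * g s.toNNReal) :=
  intervalIntegral.continuous_primitive (fun a b => hg.intervalIntegrable_exp_mul lam a b) 0

lemma IsCadlag.ouPath (hg : IsCadlag g) (lam x : ℝ) : IsCadlag (ouPath lam x g) := by
  have h := hg.continuous_integral_exp_mul lam
  refine IsCadlag.add (Continuous.isCadlag ?_) hg
  fun_prop

/-- `ouPath` solves the equation. -/
lemma ouPath_eq (hg : IsCadlag g) (t : ℝ≥0) :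
    ouPath lam x g t = x + (∫ s in (0 : ℝ)..t, -lam * ouPath lam x g s.toNNReal) + g t := by
  -- The solution minus the noise: the jumps of `g` cancel and a continuous function remains.
  let K : ℝ → ℝ := fun t =>
    Real.exp (-lam * t) * (x - lam * ∫ s in (0 : ℝ)..t, Real.exp (lam * s) * g s.toNNReal)
  have hK : Continuous K := by
    have h := hg.continuous_integral_exp_mul lam
    fun_prop
  have hKz : ∀ s : ℝ, 0 ≤ s → ouPath lam x g s.toNNReal = K s + g s.toNNReal := fun s hs => by
    simp [ouPath, K, hs]
  have hderiv : ∀ s ∈ Ioo (min 0 (t : ℝ)) (max 0 (t : ℝ)),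
      HasDerivWithinAt K (-lam * ouPath lam x g s.toNNReal) (Ioi s) s := fun s hs => by
    have hs0 : 0 ≤ s := by
      have := hs.1
      rw [min_eq_left t.coe_nonneg] at this
      exact this.le
    rw [hKz s hs0]
    have h1 : HasDerivWithinAt (fun s => Real.exp (-lam * s)) (Real.exp (-lam * s) * -lam)
        (Ioi s) s := by
      simpa using ((hasDerivAt_id s).const_mul (-lam)).exp.hasDerivWithinAt
    have h2 := h1.mul (((hg.hasDerivWithinAt_integral_exp_mul lam s).const_mul lam).const_sub x)
    refine h2.congr_deriv ?_
    have h3 : Real.exp (-lam * s) * Real.exp (lam * s) = 1 := by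
      rw [← Real.exp_add]; simp
    linear_combination (-lam * g s.toNNReal) * h3
  have h := intervalIntegral.integral_eq_sub_of_hasDeriv_right hK.continuousOn hderiv
    (((hg.ouPath lam x).intervalIntegrable 0 t).const_mul (-lam))
  have hK0 : K 0 = x := by simp [K]
  rw [h, hK0]
  have := hKz t t.2
  simp only [Real.toNNReal_coe] at this
  rw [this]; ring

/-- `ouPath` is the only càdlàg solution of the equation. -/
lemma eq_ouPath_of_forall_eq (hg : IsCadlag g) {z : ℝ≥0 → ℝ} (hz : IsCadlag z)
    (h : ∀ t : ℝ≥0, z t = x + (∫ s in (0 : ℝ)..t, -lam * z s.toNNReal) + g t) (t : ℝ≥0) :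
    z t = ouPath lam x g t := by
  let K : ℝ → ℝ := fun t => x + ∫ s in (0 : ℝ)..t, -lam * z s.toNNReal
  have hz' : ∀ a b : ℝ, IntervalIntegrable (fun s => -lam * z s.toNNReal) volume a b :=
    fun a b => (hz.intervalIntegrable a b).const_mul _
  have hK : Continuous K := continuous_const.add (intervalIntegral.continuous_primitive hz' 0)
  -- The integrating factor removes `z` from the derivative, so `K`, and with it `z`, is determined
  -- by `g` and `x`.
  have hderiv : ∀ s ∈ Ioo (min 0 (t : ℝ)) (max 0 (t : ℝ)),
      HasDerivWithinAt (fun s => Real.exp (lam * s) * K s)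
        (-lam * (Real.exp (lam * s) * g s.toNNReal)) (Ioi s) s := fun s hs => by
    have hs0 : 0 ≤ s := by
      have := hs.1
      rw [min_eq_left t.coe_nonneg] at this
      exact this.le
    have h1 : HasDerivWithinAt (fun s => Real.exp (lam * s)) (Real.exp (lam * s) * lam)
        (Ioi s) s := by
      simpa using ((hasDerivAt_id s).const_mul lam).exp.hasDerivWithinAt
    have h2 : HasDerivWithinAt K (-lam * z s.toNNReal) (Ioi s) s := by
      refine HasDerivWithinAt.const_add x ?_
      refine (intervalIntegral.integral_hasDerivWithinAt_right (hz' 0 s) (s := Ici s)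
        (t := Ioi s) ?_ ?_).mono Ioi_subset_Ici_self
      · exact ((hz.measurable.comp measurable_real_toNNReal).const_mul
          (-lam)).stronglyMeasurable.stronglyMeasurableAtFilter
      · exact ContinuousWithinAt.mul (by fun_prop)
          ((hz.continuousWithinAt_toNNReal s).mono Ioi_subset_Ici_self)
    refine (h1.mul h2).congr_deriv ?_
    have h3 := h s.toNNReal
    rw [Real.coe_toNNReal s hs0] at h3
    have h4 : z s.toNNReal = K s + g s.toNNReal := h3
    rw [h4]; ring
  have hint := intervalIntegral.integral_eq_sub_of_hasDeriv_right
    (a := 0) (b := (t : ℝ)) (f := fun s => Real.exp (lam * s) * K s)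
    (by fun_prop) hderiv ((hg.intervalIntegrable_exp_mul lam 0 t).const_mul (-lam))
  rw [intervalIntegral.integral_const_mul] at hint
  have hK0 : K 0 = x := by simp [K]
  simp only [hK0, mul_zero, Real.exp_zero, one_mul] at hint
  have h3 : Real.exp (-lam * t) * Real.exp (lam * t) = 1 := by
    rw [← Real.exp_add]; simp
  have h4 : z t = K t + g t := h t
  rw [h4, ouPath]
  linear_combination (-K t) * h3 - Real.exp (-lam * t) * hint

end Scalar

/-! ### Riemann sums along sequences of partitions -/

/-- A sequence of partitions `0 = u k 0 ≤ ⋯ ≤ u k (m k) = t` with mesh tending to `0`. -/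
structure IsPartitionSeq (t : ℝ≥0) (m : ℕ → ℕ) (u : ℕ → ℕ → ℝ≥0) : Prop where
  mono : ∀ k, Monotone (u k)
  zero : ∀ k, u k 0 = 0
  last : ∀ k, u k (m k) = t
  mesh : ∀ δ : ℝ, 0 < δ → ∀ᶠ k in atTop, ∀ i < m k, (u k (i + 1) : ℝ) - u k i ≤ δ

/-- The uniform partitions of `[0, t]` into `k + 1` pieces. -/
lemma isPartitionSeq_uniform (t : ℝ≥0) :
    IsPartitionSeq t (fun k => k + 1) (fun k i => t * (i / (k + 1))) where
  mono k i j hij := by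
    have : (i : ℝ≥0) ≤ j := by exact_mod_cast hij
    dsimp only
    gcongr
  zero k := by simp
  last k := by
    have : ((k + 1 : ℕ) : ℝ≥0) / (k + 1) = 1 := by
      push_cast
      exact div_self (by positivity)
    rw [this, mul_one]
  mesh δ hδ := by
    have h : Tendsto (fun k : ℕ => (t : ℝ) * (1 / ((k : ℝ) + 1))) atTop (𝓝 0) := by
      simpa using (tendsto_one_div_add_atTop_nhds_zero_nat (𝕜 := ℝ)).const_mul (t : ℝ)
    filter_upwards [h.eventually_le_const hδ] with k hk i _
    refine le_trans (le_of_eq ?_) hk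
    push_cast
    ring

lemma exists_mem_Ioc_succ {u : ℕ → ℝ≥0} {m : ℕ} {s : ℝ≥0} (hs : s ∈ Ioc (u 0) (u m)) :
    ∃ i < m, s ∈ Ioc (u i) (u (i + 1)) := by
  induction m with
  | zero => exact absurd hs.2 (not_le.2 hs.1)
  | succ m ih =>
    by_cases h : s ≤ u m
    · obtain ⟨i, hi, his⟩ := ih ⟨hs.1, h⟩
      exact ⟨i, hi.trans (Nat.lt_succ_self m), his⟩
    · exact ⟨m, Nat.lt_succ_self m, not_le.1 h, hs.2⟩

lemma sum_indicator_Ioc_succ_eq {u : ℕ → ℝ≥0} (hu : Monotone u) {m i : ℕ} (hi : i < m)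
    {s : ℝ≥0} (hs : s ∈ Ioc (u i) (u (i + 1))) (c : ℕ → ℝ) :
    ∑ j ∈ Finset.range m, (Ioc (u j) (u (j + 1))).indicator (fun _ => c j) s = c i := by
  rw [Finset.sum_eq_single i]
  · rw [indicator_of_mem hs]
  · intro j _ hji
    refine indicator_of_notMem (fun hj => ?_) _
    exact (disjoint_left.1 (hu.pairwise_disjoint_on_Ioc_succ hji)) hj hs
  · intro h
    exact absurd (Finset.mem_range.2 hi) h

namespace IsPartitionSeq

variable {t : ℝ≥0} {m : ℕ → ℕ} {u : ℕ → ℕ → ℝ≥0}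

lemma le_last (hu : IsPartitionSeq t m u) {k i : ℕ} (hi : i ≤ m k) : u k i ≤ t :=
  hu.last k ▸ hu.mono k hi

/-- Both ends of the interval containing `s` lie within the mesh of `s`. The right end approaches
from `[s, ∞)`, which is what evaluating a càdlàg path in the limit requires. -/
lemma tendsto_right (hu : IsPartitionSeq t m u) {s : ℝ≥0} {i : ℕ → ℕ}
    (hi : ∀ k, i k < m k ∧ s ∈ Ioc (u k (i k)) (u k (i k + 1))) :
    Tendsto (fun k => u k (i k + 1)) atTop (𝓝[≥] s) := by
  refine tendsto_nhdsWithin_iff.2 ⟨?_, Eventually.of_forall fun k => (hi k).2.2⟩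
  rw [← NNReal.tendsto_coe, Metric.tendsto_nhds]
  intro ε hε
  filter_upwards [hu.mesh (ε / 2) (half_pos hε)] with k hk
  have h1 := hk _ (hi k).1
  have h2 : ((u k (i k) : ℝ≥0) : ℝ) < s := (hi k).2.1
  have h3 : (s : ℝ) ≤ u k (i k + 1) := (hi k).2.2
  rw [Real.dist_eq, abs_lt]
  constructor <;> linarith

lemma tendsto_left (hu : IsPartitionSeq t m u) {s : ℝ≥0} {i : ℕ → ℕ}
    (hi : ∀ k, i k < m k ∧ s ∈ Ioc (u k (i k)) (u k (i k + 1))) :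
    Tendsto (fun k => u k (i k)) atTop (𝓝 s) := by
  rw [← NNReal.tendsto_coe, Metric.tendsto_nhds]
  intro ε hε
  filter_upwards [hu.mesh (ε / 2) (half_pos hε)] with k hk
  have h1 := hk _ (hi k).1
  have h2 : ((u k (i k) : ℝ≥0) : ℝ) < s := (hi k).2.1
  have h3 : (s : ℝ) ≤ u k (i k + 1) := (hi k).2.2
  rw [Real.dist_eq, abs_lt]
  constructor <;> linarith

/-- Riemann sums with weights `∫ w` over the preimages, under `T`, of the partition intervals. -/
lemma tendsto_sum_mul_setIntegral (hu : IsPartitionSeq t m u) {α : Type*} [MeasurableSpace α]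
    {μ : Measure α} {T : α → ℝ≥0} (hT : Measurable T) {w : α → ℝ}
    (hw : IntegrableOn w (T ⁻¹' Ioc 0 t) μ) {c : ℕ → ℕ → ℝ} {y : ℝ≥0 → ℝ} {C : ℝ}
    (hC : ∀ k, ∀ i < m k, |c k i| ≤ C)
    (hc : ∀ s ∈ Ioc 0 t, ∀ i : ℕ → ℕ, (∀ k, i k < m k ∧ s ∈ Ioc (u k (i k)) (u k (i k + 1))) →
      Tendsto (fun k => c k (i k)) atTop (𝓝 (y s))) :
    Tendsto (fun k => ∑ i ∈ Finset.range (m k),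
        c k i * ∫ a in T ⁻¹' Ioc (u k i) (u k (i + 1)), w a ∂μ) atTop
      (𝓝 (∫ a in T ⁻¹' Ioc 0 t, y (T a) * w a ∂μ)) := by
  have hmeas : ∀ a b : ℝ≥0, MeasurableSet (T ⁻¹' Ioc a b) := fun a b => hT measurableSet_Ioc
  have hsub : ∀ k, ∀ i < m k, T ⁻¹' Ioc (u k i) (u k (i + 1)) ⊆ T ⁻¹' Ioc 0 t := fun k i hi =>
    preimage_mono (Ioc_subset_Ioc zero_le (hu.le_last hi))
  -- The sum is the integral of a step function times `w`; the step function converges pointwise and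
  -- is bounded by `C`, so dominated convergence applies.
  have hsum : ∀ k, ∑ i ∈ Finset.range (m k),
      c k i * ∫ a in T ⁻¹' Ioc (u k i) (u k (i + 1)), w a ∂μ =
      ∫ a in T ⁻¹' Ioc 0 t, (∑ i ∈ Finset.range (m k),
        (Ioc (u k i) (u k (i + 1))).indicator (fun _ => c k i) (T a)) * w a ∂μ := fun k => by
    have h1 : ∀ i a, (Ioc (u k i) (u k (i + 1))).indicator (fun _ => c k i) (T a) * w a =
        (T ⁻¹' Ioc (u k i) (u k (i + 1))).indicator (fun a => c k i * w a) a := fun i a => by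
      by_cases h : T a ∈ Ioc (u k i) (u k (i + 1))
      · rw [indicator_of_mem h, indicator_of_mem (by exact h)]
      · rw [indicator_of_notMem h, indicator_of_notMem (by exact h), zero_mul]
    simp_rw [Finset.sum_mul, h1]
    rw [integral_finsetSum]
    · refine Finset.sum_congr rfl fun i hi => ?_
      rw [setIntegral_indicator (hmeas _ _), inter_eq_right.2 (hsub k i (Finset.mem_range.1 hi)),
        integral_const_mul]
    · exact fun i _ => (hw.const_mul (c k i)).indicator (hmeas _ _)
  have hstep : ∀ s ∈ Ioc 0 t, ∃ i : ℕ → ℕ,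
      ∀ k, i k < m k ∧ s ∈ Ioc (u k (i k)) (u k (i k + 1)) := fun s hs => by
    have : ∀ k, ∃ i, i < m k ∧ s ∈ Ioc (u k i) (u k (i + 1)) := fun k =>
      exists_mem_Ioc_succ (by rwa [hu.zero, hu.last])
    choose i hi using this
    exact ⟨i, hi⟩
  simp_rw [hsum]
  refine tendsto_integral_of_dominated_convergence (fun a => C * ‖w a‖) (fun k => ?_)
    (hw.norm.const_mul C) (fun k => ?_) ?_
  · refine AEStronglyMeasurable.mul (Measurable.aestronglyMeasurable ?_) hw.aestronglyMeasurable
    exact Finset.measurable_sum _ fun i _ =>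
      (measurable_const.indicator measurableSet_Ioc).comp hT
  · refine (ae_restrict_iff' (hmeas _ _)).2 (Eventually.of_forall fun a ha => ?_)
    obtain ⟨i, hi⟩ := hstep _ ha
    rw [sum_indicator_Ioc_succ_eq (hu.mono k) (hi k).1 (hi k).2, norm_mul]
    exact mul_le_mul_of_nonneg_right (hC k _ (hi k).1) (norm_nonneg _)
  · refine (ae_restrict_iff' (hmeas _ _)).2 (Eventually.of_forall fun a ha => ?_)
    obtain ⟨i, hi⟩ := hstep _ ha
    have : ∀ k, ∑ j ∈ Finset.range (m k),
        (Ioc (u k j) (u k (j + 1))).indicator (fun _ => c k j) (T a) = c k (i k) := fun k =>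
      sum_indicator_Ioc_succ_eq (hu.mono k) (hi k).1 (hi k).2 _
    simp_rw [this]
    exact (hc _ ha i hi).mul_const _

/-- Left-point Riemann-Stieltjes sums of a continuous function against a time change. -/
lemma tendsto_sum_mul_timeChange (hu : IsPartitionSeq t m u) (ℓ : TimeChange) {y : ℝ≥0 → ℝ}
    (hy : Continuous y) :
    Tendsto (fun k => ∑ i ∈ Finset.range (m k),
      y (u k i) * ((ℓ (u k (i + 1)) : ℝ) - ℓ (u k i))) atTop (𝓝 (ℓ.integral y t)) := by
  obtain ⟨C, hC⟩ := hy.isCadlag.exists_norm_le t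
  have hfin : ℓ.stieltjes.measure (Ioc 0 t) ≠ ∞ := by
    rw [StieltjesFunction.measure_Ioc]; exact ENNReal.ofReal_ne_top
  have h := hu.tendsto_sum_mul_setIntegral (μ := ℓ.stieltjes.measure) (T := id) measurable_id
    (w := fun _ => 1) (integrableOn_const hfin) (c := fun k i => y (u k i)) (y := y) (C := C)
    (fun k i hi => hC _ (hu.le_last hi.le))
    (fun s _ i hi => (hy.tendsto s).comp (hu.tendsto_left hi))
  simp only [preimage_id, id, mul_one, integral_const, smul_eq_mul, measureReal_restrict_apply_univ]
    at h
  refine h.congr fun k => Finset.sum_congr rfl fun i _ => ?_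
  rw [Measure.real, StieltjesFunction.measure_Ioc, ENNReal.toReal_ofReal]
  · rfl
  · exact sub_nonneg.2 (ℓ.stieltjes.mono (hu.mono k (Nat.le_succ i)))

/-- Left-point sums of `exp (-lam * (t - ·))` against a càdlàg path converge, by summation by
parts. -/
lemma tendsto_sum_exp_mul_sub (hu : IsPartitionSeq t m u) (lam : ℝ) {y : ℝ≥0 → ℝ}
    (hy : IsCadlag y) :
    Tendsto (fun k => ∑ i ∈ Finset.range (m k),
      Real.exp (-lam * ((t : ℝ) - u k i)) * (y (u k (i + 1)) - y (u k i))) atTop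
      (𝓝 (ouPath lam 0 (fun s => y s - y 0) t)) := by
  -- Starting the path at `0` kills the lower boundary term in the summation by parts.
  let g : ℝ≥0 → ℝ := fun s => y s - y 0
  have hg : IsCadlag g := hy.comp_continuous (continuous_id.sub continuous_const)
  have hg0 : g 0 = 0 := sub_self _
  let f : ℝ → ℝ := fun s => Real.exp (-lam * ((t : ℝ) - s))
  let f' : ℝ → ℝ := fun s => lam * (Real.exp (-lam * t) * Real.exp (lam * s))
  have hff' : ∀ s, HasDerivAt f (f' s) s := fun s => by
    have h1 : HasDerivAt (fun s : ℝ => -lam * ((t : ℝ) - s)) lam s := by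
      simpa using ((hasDerivAt_id s).const_sub (t : ℝ)).const_mul (-lam)
    refine h1.exp.congr_deriv ?_
    simp only [f']
    rw [← Real.exp_add, mul_comm]
    congr 2; ring
  have hf'c : Continuous f' := by fun_prop
  obtain ⟨C, hC⟩ := hg.exists_norm_le t
  have hpre : ∀ a b : ℝ≥0, Real.toNNReal ⁻¹' Ioc a b = Ioc (a : ℝ) b := fun a b => by
    ext s
    simp only [mem_preimage, mem_Ioc]
    rw [Real.lt_toNNReal_iff_coe_lt, Real.toNNReal_le_iff_le_coe]
  -- After summation by parts, `g` is sampled at right endpoints and weighted by the increments of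
  -- `f`, that is, by integrals of `f'`.
  have h := hu.tendsto_sum_mul_setIntegral (μ := volume) (T := Real.toNNReal)
    measurable_real_toNNReal (w := f') (by rw [hpre]; exact hf'c.integrableOn_Ioc)
    (c := fun k i => g (u k (i + 1))) (y := g) (C := C)
    (fun k i hi => hC _ (hu.le_last hi))
    (fun s _ i hi => (hg s).1.tendsto.comp (hu.tendsto_right hi))
  simp only [hpre] at h
  have hlim : (g t - ∫ s in Ioc ((0 : ℝ≥0) : ℝ) t, g s.toNNReal * f' s) = ouPath lam 0 g t := by
    rw [NNReal.coe_zero, ← intervalIntegral.integral_of_le t.coe_nonneg]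
    have : ∀ s : ℝ, g s.toNNReal * f' s =
        lam * Real.exp (-lam * t) * (Real.exp (lam * s) * g s.toNNReal) := fun s => by
      simp only [f']; ring
    simp_rw [this]
    rw [intervalIntegral.integral_const_mul, ouPath]
    ring
  change Tendsto _ _ (𝓝 (ouPath lam 0 g t))
  rw [← hlim]
  refine (h.const_sub (g t)).congr fun k => ?_
  have hincr : ∀ i, ∫ s in Ioc ((u k i : ℝ≥0) : ℝ) (u k (i + 1)), f' s =
      f (u k (i + 1)) - f (u k i) := fun i => by
    rw [← intervalIntegral.integral_of_le (NNReal.coe_le_coe.2 (hu.mono k (Nat.le_succ i)))]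
    exact intervalIntegral.integral_eq_sub_of_hasDerivAt (fun s _ => hff' s)
      (hf'c.intervalIntegrable _ _)
  have htel := Finset.sum_range_sub (fun i => f (u k i) * g (u k i)) (m k)
  simp only [hu.zero, hu.last, hg0, mul_zero, sub_zero] at htel
  have hft : f t = 1 := by simp [f]
  rw [hft, one_mul] at htel
  rw [← htel, ← Finset.sum_sub_distrib]
  refine Finset.sum_congr rfl fun i _ => ?_
  rw [hincr]
  simp only [f, g]
  ring

end IsPartitionSeq

/-! ### Stochastic integrals of exponentials against càdlàg processes -/

section StochIntegral

variable {Ω : Type*} [MeasurableSpace Ω] {P : Measure Ω}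

lemma IsStochIntegral.tendstoInMeasure {f : ℝ≥0 → ℝ} {Y : ℝ≥0 → Ω → ℝ} {t : ℝ≥0} {I : Ω → ℝ}
    (hI : IsStochIntegral P f Y t I) {m : ℕ → ℕ} {u : ℕ → ℕ → ℝ≥0} (hu : IsPartitionSeq t m u) :
    TendstoInMeasure P (fun k ω => ∑ i ∈ Finset.range (m k),
      f (u k i) * (Y (u k (i + 1)) ω - Y (u k i) ω)) atTop I := by
  rw [tendstoInMeasure_iff_dist]
  intro ε hε
  rw [ENNReal.tendsto_nhds_zero]
  intro η hη
  by_cases hη' : η = ∞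
  · simp [hη']
  have hη0 : 0 < η.toReal := ENNReal.toReal_pos hη.ne' hη'
  -- In `IsStochIntegral` one number bounds both the deviation and its probability; the minimum
  -- serves for both.
  obtain ⟨δ, hδ, h⟩ := hI.2 (min ε η.toReal) (lt_min hε hη0)
  filter_upwards [hu.mesh δ hδ] with k hk
  calc P {ω | ε ≤ dist (∑ i ∈ Finset.range (m k),
          f (u k i) * (Y (u k (i + 1)) ω - Y (u k i) ω)) (I ω)}
      ≤ P {ω | min ε η.toReal ≤ |∑ i ∈ Finset.range (m k),
          f (u k i) * (Y (u k (i + 1)) ω - Y (u k i) ω) - I ω|} :=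
        measure_mono fun ω hω => le_trans (min_le_left _ _) (mem_ofPred_eq ▸ hω)
    _ ≤ ENNReal.ofReal (min ε η.toReal) := h _ _ (hu.mono k) (hu.zero k) (hu.last k) hk
    _ ≤ ENNReal.ofReal η.toReal := ENNReal.ofReal_le_ofReal (min_le_right _ _)
    _ = η := ENNReal.ofReal_toReal hη'

lemma IsStochIntegral.ae_eq {f : ℝ≥0 → ℝ} {Y : ℝ≥0 → Ω → ℝ} {t : ℝ≥0} {I I' : Ω → ℝ}
    (hI : IsStochIntegral P f Y t I) (hI' : IsStochIntegral P f Y t I') : I =ᵐ[P] I' :=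
  tendstoInMeasure_ae_unique (hI.tendstoInMeasure (isPartitionSeq_uniform t))
    (hI'.tendstoInMeasure (isPartitionSeq_uniform t))

lemma IsStochIntegral.isStochIntegral_stochIntegral {f : ℝ≥0 → ℝ} {Y : ℝ≥0 → Ω → ℝ} {t : ℝ≥0}
    {I : Ω → ℝ} (hI : IsStochIntegral P f Y t I) :
    IsStochIntegral P f Y t (stochIntegral P f Y t) := by
  have h : ∃ I, IsStochIntegral P f Y t I := ⟨I, hI⟩
  rw [stochIntegral, dif_pos h]
  exact h.choose_spec

/-- Almost sure convergence along all sequences of partitions gives the stochastic integral. -/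
lemma isStochIntegral_of_forall_tendsto [IsFiniteMeasure P] {f : ℝ≥0 → ℝ} {Y : ℝ≥0 → Ω → ℝ}
    {t : ℝ≥0} {I : Ω → ℝ} (hY : ∀ s, Measurable (Y s))
    (h : ∀ m u, IsPartitionSeq t m u → ∀ᵐ ω ∂P, Tendsto (fun k => ∑ i ∈ Finset.range (m k),
      f (u k i) * (Y (u k (i + 1)) ω - Y (u k i) ω)) atTop (𝓝 (I ω))) :
    IsStochIntegral P f Y t I := by
  have hmeas : ∀ (m : ℕ) (u : ℕ → ℝ≥0), Measurable fun ω => ∑ i ∈ Finset.range m,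
      f (u i) * (Y (u (i + 1)) ω - Y (u i) ω) := fun m u =>
    Finset.measurable_sum _ fun i _ => ((hY _).sub (hY _)).const_mul _
  refine ⟨aemeasurable_of_tendsto_metrizable_ae atTop (fun k => (hmeas _ _).aemeasurable)
    (h _ _ (isPartitionSeq_uniform t)), fun ε hε => ?_⟩
  -- Failure at `ε` would supply bad partitions of mesh at most `1 / (k + 1)`, a partition sequence
  -- along which almost sure convergence forces convergence in probability.
  by_contra! hcon
  have hδ : ∀ k : ℕ, (0 : ℝ) < 1 / ((k : ℝ) + 1) := fun k => by positivity
  choose m u hmono hzero hlast hmesh hlt using fun k : ℕ => hcon _ (hδ k)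
  have hu : IsPartitionSeq t m u := ⟨hmono, hzero, hlast, fun δ hδ' => by
    filter_upwards [(tendsto_one_div_add_atTop_nhds_zero_nat (𝕜 := ℝ)).eventually_le_const hδ']
      with k hk i hi using (hmesh k i hi).trans hk⟩
  have hlim := tendstoInMeasure_of_tendsto_ae
    (fun k => (hmeas (m k) (u k)).aestronglyMeasurable) (h m u hu)
  rw [tendstoInMeasure_iff_dist] at hlim
  have h0 : 0 < ENNReal.ofReal ε := ENNReal.ofReal_pos.2 hε
  obtain ⟨k, hk⟩ := ((hlim ε hε).eventually_lt_const h0).exists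
  exact lt_asymm hk (hlt k)

lemma isStochIntegral_ouPath [IsFiniteMeasure P] {Y : ℝ≥0 → Ω → ℝ} (hY : ∀ s, Measurable (Y s))
    (hcad : ∀ᵐ ω ∂P, IsCadlag fun s => Y s ω) (lam : ℝ) (t : ℝ≥0) :
    IsStochIntegral P (fun s => Real.exp (-lam * ((t : ℝ) - s))) Y t
      (fun ω => ouPath lam 0 (fun s => Y s ω - Y 0 ω) t) :=
  isStochIntegral_of_forall_tendsto hY fun m u hu => by
    filter_upwards [hcad] with ω hω using hu.tendsto_sum_exp_mul_sub lam hω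

/-! ### The law of the stochastic integrals against a time-changed Brownian motion -/

/-- Almost sure limits of centred Gaussian variables with convergent variances are Gaussian. -/
lemma hasLaw_gaussianReal_of_tendsto [IsProbabilityMeasure P] {S : ℕ → Ω → ℝ} {I : Ω → ℝ}
    {v : ℕ → ℝ≥0} {w : ℝ≥0} (hS : ∀ k, HasLaw (S k) (gaussianReal 0 (v k)) P)
    (hv : Tendsto v atTop (𝓝 w)) (hI : ∀ᵐ ω ∂P, Tendsto (fun k => S k ω) atTop (𝓝 (I ω))) :
    HasLaw I (gaussianReal 0 w) P := by
  have hImeas : AEMeasurable I P :=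
    aemeasurable_of_tendsto_metrizable_ae atTop (fun k => (hS k).aemeasurable) hI
  refine ⟨hImeas, ?_⟩
  have : IsProbabilityMeasure (P.map I) := Measure.isProbabilityMeasure_map hImeas
  -- Characteristic functions are continuous in the variance, so the degenerate limit `w = 0` needs
  -- no separate case.
  refine Measure.ext_of_charFun (funext fun θ => ?_)
  have hexp : ∀ {X : Ω → ℝ}, AEMeasurable X P →
      charFun (P.map X) θ = ∫ ω, Complex.exp (θ * X ω * Complex.I) ∂P := fun hX => by
    rw [charFun_apply_real, integral_map hX (by fun_prop)]
  have h1 : Tendsto (fun k => charFun (P.map (S k)) θ) atTop (𝓝 (charFun (P.map I) θ)) := by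
    simp_rw [hexp hImeas, fun k => hexp (hS k).aemeasurable]
    refine tendsto_integral_of_dominated_convergence (fun _ => 1) (fun k => ?_)
      (integrable_const _) (fun k => Eventually.of_forall fun ω => ?_) ?_
    · have := (hS k).aemeasurable
      exact (by fun_prop : AEMeasurable
        (fun ω => Complex.exp (θ * S k ω * Complex.I)) P).aestronglyMeasurable
    · rw [← Complex.ofReal_mul, Complex.norm_exp_ofReal_mul_I]
    · filter_upwards [hI] with ω hω
      have hc : Continuous fun x : ℝ => Complex.exp (θ * x * Complex.I) := by fun_prop
      exact (hc.tendsto _).comp hω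
  have h2 : Tendsto (fun k => charFun (P.map (S k)) θ) atTop
      (𝓝 (charFun (gaussianReal 0 w) θ)) := by
    simp_rw [fun k => (hS k).map_eq, charFun_gaussianReal]
    have hc : Continuous fun r : ℝ≥0 =>
        Complex.exp (θ * (0 : ℝ) * Complex.I - (r : ℝ) * θ ^ 2 / 2) := by fun_prop
    exact (hc.tendsto w).comp hv
  exact tendsto_nhds_unique h1 h2

/-- The law of a weighted sum of Brownian increments. -/
lemma ProbabilityTheory.IsPreBrownianReal.hasLaw_sum_mul_sub {B : ℝ≥0 → Ω → ℝ}
    (hB : IsPreBrownianReal B P) {τ : ℕ → ℝ≥0} (hτ : Monotone τ) (c : ℕ → ℝ) (m : ℕ) :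
    HasLaw (fun ω => ∑ i ∈ Finset.range m, c i * (B (τ (i + 1)) ω - B (τ i) ω))
      (gaussianReal 0 (∑ i ∈ Finset.range m, c i ^ 2 * ((τ (i + 1) : ℝ) - τ i)).toNNReal) P := by
  have hprob := hB.isGaussianProcess.isProbabilityMeasure
  have hd : ∀ i, HasLaw (fun ω => c i * (B (τ (i + 1)) ω - B (τ i) ω))
      (gaussianReal 0 (c i ^ 2 * ((τ (i + 1) : ℝ) - τ i)).toNNReal) P := fun i => by
    have h := gaussianReal_const_mul (hB.hasLaw_sub (τ (i + 1)) (τ i)) (c i)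
    have hle : (τ i : ℝ) ≤ τ (i + 1) := hτ (Nat.le_succ i)
    have hvar : (c i ^ 2 * ((τ (i + 1) : ℝ) - τ i)).toNNReal =
        .mk (c i ^ 2) (sq_nonneg _) * nndist (τ (i + 1)).1 (τ i).1 := by
      apply NNReal.coe_injective
      rw [Real.coe_toNNReal _ (mul_nonneg (sq_nonneg _) (sub_nonneg.2 hle))]
      simp only [NNReal.coe_mul, NNReal.coe_mk, coe_nndist]
      congr 1
      exact (abs_of_nonneg (sub_nonneg.2 hle)).symm
    rw [mul_zero] at h
    rw [hvar]
    exact h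
  have hind : iIndepFun (fun i ω => c i * (B (τ (i + 1)) ω - B (τ i) ω)) P :=
    (hB.hasIndepIncrements.nat hτ).comp (fun i x => c i * x) fun i => by fun_prop
  induction m with
  | zero =>
    simp only [Finset.range_zero, Finset.sum_empty, Real.toNNReal_zero, gaussianReal_zero_var]
    exact ⟨by fun_prop, by simp⟩
  | succ m ih =>
    have hm : IndepFun (fun ω => ∑ i ∈ Finset.range m, c i * (B (τ (i + 1)) ω - B (τ i) ω))
        (fun ω => c m * (B (τ (m + 1)) ω - B (τ m) ω)) P := by
      have := hind.indepFun_finsetSum_of_notMem₀ (fun i => (hd i).aemeasurable)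
        (s := Finset.range m) (i := m) (by simp)
      convert this using 1
      ext ω; simp
    have hadd := gaussianReal_add_gaussianReal_of_indepFun hm ih.map_eq (hd m).map_eq
    simp only [Finset.sum_range_succ]
    have hnn : ∀ i, 0 ≤ c i ^ 2 * ((τ (i + 1) : ℝ) - τ i) := fun i =>
      mul_nonneg (sq_nonneg _) (sub_nonneg.2 (hτ (Nat.le_succ i)))
    rw [Real.toNNReal_add (Finset.sum_nonneg fun i _ => hnn i) (hnn m)]
    rw [add_zero] at hadd
    exact ⟨ih.aemeasurable.add (hd m).aemeasurable, hadd⟩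

lemma ProbabilityTheory.IsBrownianReal.ae_isCadlag_timeChange {B : ℝ≥0 → Ω → ℝ}
    (hB : IsBrownianReal B P) (ℓ : TimeChange) : ∀ᵐ ω ∂P, IsCadlag fun s => B (ℓ s) ω := by
  filter_upwards [hB.cont] with ω hω using ℓ.cadlag'.comp_continuous hω

lemma TimeChange.integral_exp_nonneg (ℓ : TimeChange) (lam : ℝ) (t : ℝ≥0) :
    0 ≤ ℓ.integral (fun s => Real.exp (-2 * lam * ((t : ℝ) - s))) t :=
  integral_nonneg fun _ => (Real.exp_pos _).le

lemma TimeChange.integrableOn_of_continuous (ℓ : TimeChange) {y : ℝ≥0 → ℝ} (hy : Continuous y)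
    (t : ℝ≥0) : IntegrableOn y (Ioc 0 t) ℓ.stieltjes.measure := by
  obtain ⟨C, hC⟩ := hy.isCadlag.exists_norm_le t
  refine Measure.integrableOn_of_bounded (M := C) ?_ hy.aestronglyMeasurable ?_
  · rw [StieltjesFunction.measure_Ioc]; exact ENNReal.ofReal_ne_top
  · exact (ae_restrict_iff' measurableSet_Ioc).2 (Eventually.of_forall fun s hs => hC s hs.2)

/-- The integrand is positive and `(0, t]` has mass `ℓ t - ℓ 0 = ℓ t > 0`. This supplies the
nondegeneracy behind the derivative formula. -/
lemma TimeChange.integral_exp_pos (ℓ : TimeChange) (lam : ℝ) {t : ℝ≥0} (ht : 0 < t) :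
    0 < ℓ.integral (fun s => Real.exp (-2 * lam * ((t : ℝ) - s))) t := by
  have hm : ℓ.stieltjes.measure (Ioc 0 t) = ENNReal.ofReal (ℓ t) := by
    rw [StieltjesFunction.measure_Ioc]
    congr 1
    change (ℓ t : ℝ) - ℓ 0 = ℓ t
    rw [ℓ.map_zero']; simp
  rw [TimeChange.integral, setIntegral_pos_iff_support_of_nonneg_ae
    (Eventually.of_forall fun _ => (Real.exp_pos _).le)
    (ℓ.integrableOn_of_continuous (by fun_prop) t)]
  have : Function.support (fun s : ℝ≥0 => Real.exp (-2 * lam * ((t : ℝ) - s))) = univ :=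
    Function.support_eq_univ fun s => (Real.exp_pos _).ne'
  rw [this, univ_inter, hm]
  exact ENNReal.ofReal_pos.2 (ℓ.pos' t ht)

/-- A discrete Itô isometry: the variances of the left-point sums are Stieltjes sums of the squared
integrand, and both converge along uniform partitions. -/
lemma ProbabilityTheory.IsBrownianReal.hasLaw_ouPath {B : ℝ≥0 → Ω → ℝ}
    (hB : IsBrownianReal B P) (ℓ : TimeChange) (lam : ℝ) (t : ℝ≥0) :
    HasLaw (fun ω => ouPath lam 0 (fun s => B (ℓ s) ω - B (ℓ 0) ω) t)
      (gaussianReal 0 (ℓ.integral (fun s => Real.exp (-2 * lam * ((t : ℝ) - s))) t).toNNReal)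
      P := by
  have hprob := hB.isGaussianProcess.isProbabilityMeasure
  have hu := isPartitionSeq_uniform t
  refine hasLaw_gaussianReal_of_tendsto (fun k => hB.hasLaw_sum_mul_sub
    (ℓ.monotone'.comp (hu.mono k)) (fun i => Real.exp (-lam * ((t : ℝ) - (t * (i / (k + 1)) : ℝ≥0)))) (k + 1)) ?_ ?_
  · refine (continuous_real_toNNReal.tendsto _).comp ?_
    refine (hu.tendsto_sum_mul_timeChange ℓ (y := fun s => Real.exp (-2 * lam * ((t : ℝ) - s)))
      (by fun_prop)).congr fun k => Finset.sum_congr rfl fun i _ => ?_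
    rw [← Real.exp_nat_mul]
    simp only [Function.comp]
    congr 2
    push_cast; ring
  · filter_upwards [hB.ae_isCadlag_timeChange ℓ] with ω hω
    exact hu.tendsto_sum_exp_mul_sub lam hω

/-- Stochastic integrals against independent time-changed Brownian motions are independent. -/
lemma iIndepFun_ouPath {ι : Type*} {β : ι → ℝ≥0 → Ω → ℝ} (hβ : ∀ n, IsBrownianReal (β n) P)
    (hβ_indep : iIndepFun (fun n ω => fun t : ℝ≥0 => β n t ω) P) (ℓ : TimeChange) (lam : ι → ℝ)
    (t : ℝ≥0) :
    iIndepFun (fun n ω => ouPath (lam n) 0 (fun s => β n (ℓ s) ω - β n (ℓ 0) ω) t) P := by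
  have hu := isPartitionSeq_uniform t
  -- Each sum reads finitely many values of the path, so its `limUnder` is measurable for the
  -- product σ-algebra, which is not evident for `ouPath` itself. The two agree almost surely.
  let S : ι → ℕ → (ℝ≥0 → ℝ) → ℝ := fun n k b => ∑ i ∈ Finset.range (k + 1),
    Real.exp (-lam n * ((t : ℝ) - (t * (i / (k + 1)) : ℝ≥0))) *
      (b (ℓ (t * ((i + 1 : ℕ) / (k + 1)))) - b (ℓ (t * (i / (k + 1)))))
  have hS : ∀ n k, Measurable (S n k) := fun n k => Finset.measurable_sum _ fun i _ => by fun_prop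
  have hlim : ∀ n, Measurable fun b => limUnder atTop fun k => S n k b := fun n =>
    (StronglyMeasurable.limUnder fun k => (hS n k).stronglyMeasurable).measurable
  refine (hβ_indep.comp _ hlim).congr fun n => ?_
  filter_upwards [(hβ n).ae_isCadlag_timeChange ℓ] with ω hω
  exact (hu.tendsto_sum_exp_mul_sub (lam n) hω).limUnder_eq

/-- The joint law of the stochastic integrals. -/
lemma hasLaw_pi_ouPath {ι : Type*} [Fintype ι] [IsProbabilityMeasure P] {β : ι → ℝ≥0 → Ω → ℝ}
    (hβ : ∀ n, IsBrownianReal (β n) P)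
    (hβ_indep : iIndepFun (fun n ω => fun t : ℝ≥0 => β n t ω) P) (ℓ : TimeChange) (lam : ι → ℝ)
    (t : ℝ≥0) :
    HasLaw (fun ω n => ouPath (lam n) 0 (fun s => β n (ℓ s) ω - β n (ℓ 0) ω) t)
      (Measure.pi fun n => gaussianReal 0
        (ℓ.integral (fun s => Real.exp (-2 * lam n * ((t : ℝ) - s))) t).toNNReal) P := by
  have hlaw := fun n => (hβ n).hasLaw_ouPath ℓ (lam n) t
  refine ⟨aemeasurable_pi_lambda _ fun n => (hlaw n).aemeasurable, ?_⟩
  rw [(iIndepFun_iff_map_fun_eq_pi_map fun n => (hlaw n).aemeasurable).1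
    (iIndepFun_ouPath hβ hβ_indep ℓ lam t)]
  simp_rw [fun n => (hlaw n).map_eq]

end StochIntegral

/-! ### Shifts of Gaussian product measures -/

section GaussianShift

/-- The ratio of the two densities: `-(y - a)² / (2v) + y² / (2v) = a y / v - a² / (2v)`. -/
lemma gaussianReal_eq_withDensity_gaussianReal_zero (a : ℝ) {v : ℝ≥0} (hv : v ≠ 0) :
    gaussianReal a v = (gaussianReal 0 v).withDensity
      fun y => ENNReal.ofReal (Real.exp (a * y / v - a ^ 2 / (2 * v))) := by
  have hv' : (v : ℝ) ≠ 0 := by exact_mod_cast hv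
  rw [gaussianReal_of_var_ne_zero _ hv, gaussianReal_of_var_ne_zero _ hv,
    ← withDensity_mul _ (measurable_gaussianPDF 0 v) (by fun_prop)]
  congr 1
  ext y
  rw [Pi.mul_apply, gaussianPDF, gaussianPDF,
    ← ENNReal.ofReal_mul (gaussianPDFReal_nonneg _ _ _)]
  congr 1
  rw [gaussianPDFReal, gaussianPDFReal, mul_assoc (√(2 * Real.pi * v))⁻¹, ← Real.exp_add]
  congr 2
  field_simp
  ring

/-- On a rectangle the indicator times the density is a product of functions of independent
coordinates, so its integral factorizes. -/
lemma MeasureTheory.Measure.pi_withDensity {ι : Type*} [Fintype ι] {X : ι → Type*}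
    [∀ i, MeasurableSpace (X i)] (μ : ∀ i, Measure (X i)) [∀ i, IsProbabilityMeasure (μ i)]
    {f : ∀ i, X i → ℝ≥0∞} (hf : ∀ i, Measurable (f i)) [∀ i, SigmaFinite ((μ i).withDensity (f i))] :
    Measure.pi (fun i => (μ i).withDensity (f i)) =
      (Measure.pi μ).withDensity fun x => ∏ i, f i (x i) := by
  refine Measure.pi_eq fun s hs => ?_
  have hind : iIndepFun (fun i (x : ∀ i, X i) => (s i).indicator (f i) (x i)) (Measure.pi μ) :=
    iIndepFun_pi fun i => ((hf i).indicator (hs i)).aemeasurable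
  have hprod : ∀ x : ∀ i, X i, (univ.pi s).indicator (fun x => ∏ i, f i (x i)) x =
      ∏ i, (s i).indicator (f i) (x i) := fun x => by
    by_cases hx : x ∈ univ.pi s
    · rw [indicator_of_mem hx]
      exact Finset.prod_congr rfl fun i _ => (indicator_of_mem (hx i (mem_univ i)) _).symm
    · rw [indicator_of_notMem hx]
      simp only [Set.mem_pi, mem_univ, true_imp_iff, not_forall] at hx
      obtain ⟨i, hi⟩ := hx
      exact (Finset.prod_eq_zero (Finset.mem_univ i) (indicator_of_notMem hi _)).symm
  rw [withDensity_apply _ (MeasurableSet.univ_pi hs),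
    ← lintegral_indicator (MeasurableSet.univ_pi hs)]
  simp_rw [hprod]
  rw [lintegral_prod_eq_prod_lintegral_of_indepFun Finset.univ _ hind fun i =>
    ((hf i).indicator (hs i)).comp (measurable_pi_apply i)]
  refine Finset.prod_congr rfl fun i _ => ?_
  rw [withDensity_apply _ (hs i), ← lintegral_indicator (hs i)]
  exact (measurePreserving_eval μ i).lintegral_comp ((hf i).indicator (hs i))

variable {ι : Type*} [Fintype ι] {v : ι → ℝ≥0}

/-- The Cameron-Martin formula for a product of centred Gaussian measures. -/
lemma integral_add_pi_gaussianReal (hv : ∀ i, v i ≠ 0) (a : ι → ℝ) {ψ : (ι → ℝ) → ℝ}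
    (hψ : Measurable ψ) :
    ∫ y, ψ (a + y) ∂(Measure.pi fun i => gaussianReal 0 (v i)) =
      ∫ y, ψ y * Real.exp (∑ i, (a i * y i / v i - a i ^ 2 / (2 * v i)))
        ∂(Measure.pi fun i => gaussianReal 0 (v i)) := by
  have hshift : (Measure.pi fun i => gaussianReal 0 (v i)).map (fun y => a + y) =
      (Measure.pi fun i => gaussianReal 0 (v i)).withDensity
        fun y => ENNReal.ofReal (Real.exp (∑ i, (a i * y i / v i - a i ^ 2 / (2 * v i)))) := by
    have h1 : ∀ i, (gaussianReal 0 (v i)).map (a i + ·) = gaussianReal (a i) (v i) := fun i => by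
      rw [gaussianReal_map_const_add, zero_add]
    have h2 : (Measure.pi fun i => gaussianReal 0 (v i)).map (fun y => a + y) =
        Measure.pi fun i => (gaussianReal 0 (v i)).map (a i + ·) :=
      Measure.pi_map_pi fun i => (measurable_const_add (a i)).aemeasurable
    have h3 : (fun i => gaussianReal (a i) (v i)) = fun i => (gaussianReal 0 (v i)).withDensity
        fun y => ENNReal.ofReal (Real.exp (a i * y / v i - a i ^ 2 / (2 * v i))) :=
      funext fun i => gaussianReal_eq_withDensity_gaussianReal_zero (a i) (hv i)
    have hsf : ∀ i, SigmaFinite ((gaussianReal 0 (v i)).withDensity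
        fun y => ENNReal.ofReal (Real.exp (a i * y / v i - a i ^ 2 / (2 * v i)))) := fun i => by
      rw [← gaussianReal_eq_withDensity_gaussianReal_zero (a i) (hv i)]
      infer_instance
    rw [h2]
    simp_rw [h1]
    rw [h3, Measure.pi_withDensity _ fun i => by fun_prop]
    congr 1
    ext y
    rw [Real.exp_sum, ENNReal.ofReal_prod_of_nonneg fun i _ => (Real.exp_pos _).le]
  rw [← integral_map (f := ψ) (φ := fun y => a + y) (by fun_prop) hψ.aestronglyMeasurable, hshift,
    integral_withDensity_eq_integral_toReal_smul (by fun_prop)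
      (Eventually.of_forall fun _ => ENNReal.ofReal_lt_top)]
  refine integral_congr_ae (Eventually.of_forall fun y => ?_)
  simp only [smul_eq_mul]
  rw [ENNReal.toReal_ofReal (Real.exp_pos _).le, mul_comm]

lemma integrable_exp_sum_abs_pi_gaussianReal (c d : ι → ℝ) :
    Integrable (fun y : ι → ℝ => Real.exp (∑ i, (c i * |y i| + d i)))
      (Measure.pi fun i => gaussianReal 0 (v i)) := by
  simp_rw [Real.exp_sum]
  refine Integrable.fintype_prod (f := fun i y => Real.exp (c i * |y| + d i)) fun i => ?_
  simp_rw [Real.exp_add]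
  refine Integrable.mul_const ?_ _
  exact integrable_exp_mul_abs (X := id) (integrable_exp_mul_gaussianReal (c i))
    (integrable_exp_mul_gaussianReal (-c i))

/-- Integrals against a nondegenerate Gaussian product measure depend smoothly on the shift. -/
lemma hasFDerivAt_integral_add_pi_gaussianReal (hv : ∀ i, v i ≠ 0) {ψ : (ι → ℝ) → ℝ}
    (hψ : Measurable ψ) {C : ℝ} (hC : ∀ y, |ψ y| ≤ C) :
    Integrable (fun y => ψ y • ∑ i, (y i / v i) • ContinuousLinearMap.proj (R := ℝ)
        (φ := fun _ : ι => ℝ) i) (Measure.pi fun i => gaussianReal 0 (v i)) ∧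
    HasFDerivAt (fun a => ∫ y, ψ (a + y) ∂(Measure.pi fun i => gaussianReal 0 (v i)))
      (∫ y, ψ y • ∑ i, (y i / v i) • ContinuousLinearMap.proj (R := ℝ)
        (φ := fun _ : ι => ℝ) i ∂(Measure.pi fun i => gaussianReal 0 (v i))) 0 := by
  let γ := Measure.pi fun i => gaussianReal 0 (v i)
  let pr : ι → (ι → ℝ) →L[ℝ] ℝ := fun i => ContinuousLinearMap.proj (R := ℝ) (φ := fun _ : ι => ℝ) i
  let q : (ι → ℝ) → (ι → ℝ) → ℝ := fun a y => ∑ i, (a i * y i / v i - a i ^ 2 / (2 * v i))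
  let F : (ι → ℝ) → (ι → ℝ) → ℝ := fun a y => ψ y * Real.exp (q a y)
  let F' : (ι → ℝ) → (ι → ℝ) → ((ι → ℝ) →L[ℝ] ℝ) := fun a y =>
    (ψ y * Real.exp (q a y)) • ∑ i, ((y i - a i) / v i) • pr i
  -- For `|a i| ≤ 1` the exponent is at most `∑ |y i| / v i`, and the gradient factor is at most `∑
  -- (|y i| + 1) / v i`, hence at most its exponential; the product of the exponentials is `bd`.
  let bd : (ι → ℝ) → ℝ := fun y => C * Real.exp (∑ i, (2 / v i * |y i| + 1 / v i))
  have hC0 : 0 ≤ C := (abs_nonneg _).trans (hC 0)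
  have hvpos : ∀ i, (0 : ℝ) < v i := fun i => by
    have := hv i
    positivity
  have hbd : Integrable bd γ := (integrable_exp_sum_abs_pi_gaussianReal _ _).const_mul C
  have hpr : ∀ i, ‖pr i‖ ≤ 1 := fun i =>
    ContinuousLinearMap.opNorm_le_bound _ zero_le_one fun a => by
      rw [one_mul]; exact norm_le_pi_norm a i
  have hle : ∀ y, ∀ a ∈ Metric.ball (0 : ι → ℝ) 1, ‖F' a y‖ ≤ bd y := fun y a ha => by
    have ha1 : ∀ i, |a i| ≤ 1 := fun i =>
      (norm_le_pi_norm a i).trans (mem_ball_zero_iff.1 ha).le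
    have h1 : q a y ≤ ∑ i, 1 / v i * |y i| := Finset.sum_le_sum fun i _ => by
      have h2 : a i * y i ≤ |y i| := (le_abs_self _).trans (by
        rw [abs_mul]; exact mul_le_of_le_one_left (abs_nonneg _) (ha1 i))
      have h3 : 0 ≤ a i ^ 2 / (2 * v i) := by positivity
      have h4 : a i * y i / v i ≤ |y i| / v i := by
        have := hvpos i
        gcongr
      rw [one_div_mul_eq_div]
      linarith
    have h2 : ‖∑ i, ((y i - a i) / v i) • pr i‖ ≤ ∑ i, (1 / v i * |y i| + 1 / v i) := by
      refine norm_sum_le_of_le _ fun i _ => ?_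
      rw [norm_smul, Real.norm_eq_abs, abs_div, abs_of_pos (hvpos i)]
      refine (mul_le_of_le_one_right (by positivity) (hpr i)).trans ?_
      rw [← mul_add_one, one_div_mul_eq_div]
      have := hvpos i
      gcongr
      exact (abs_sub _ _).trans (by linarith [ha1 i])
    have h3 : ∑ i, (1 / v i * |y i| + 1 / v i) ≤
        Real.exp (∑ i, (1 / (v i : ℝ) * |y i| + 1 / v i)) := by
      linarith [Real.add_one_le_exp (∑ i, (1 / (v i : ℝ) * |y i| + 1 / v i))]
    calc ‖F' a y‖ = |ψ y| * Real.exp (q a y) * ‖∑ i, ((y i - a i) / v i) • pr i‖ := by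
          rw [norm_smul, Real.norm_eq_abs, abs_mul, Real.abs_exp]
      _ ≤ C * Real.exp (∑ i, 1 / v i * |y i|) *
          Real.exp (∑ i, (1 / (v i : ℝ) * |y i| + 1 / v i)) := by
          have := h2.trans h3
          have := hC y
          gcongr
      _ = bd y := by
          rw [mul_assoc, ← Real.exp_add, ← Finset.sum_add_distrib]
          simp only [bd]
          congr 3
          ext i; ring
  have hqm : ∀ a, Measurable (q a) := fun a => by fun_prop
  have hFm : ∀ a, AEStronglyMeasurable (F a) γ := fun a =>
    (hψ.mul (Real.measurable_exp.comp (hqm a))).aestronglyMeasurable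
  have hF'm : AEStronglyMeasurable (F' 0) γ := by
    refine (hψ.mul (Real.measurable_exp.comp (hqm 0))).aestronglyMeasurable.smul ?_
    exact (Continuous.aestronglyMeasurable (by fun_prop))
  have hF0 : Integrable (F 0) γ := by
    refine Integrable.of_bound (hFm 0) C (Eventually.of_forall fun y => ?_)
    simpa [F, q] using hC y
  have hderiv : ∀ y, ∀ a ∈ Metric.ball (0 : ι → ℝ) 1, HasFDerivAt (F · y) (F' a y) a :=
    fun y a _ => by
    have h1 : HasFDerivAt (fun a => q a y) (∑ i, ((y i - a i) / v i) • pr i) a := by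
      refine HasFDerivAt.fun_sum fun i _ => ?_
      have h2 : HasFDerivAt (fun a : ι → ℝ => a i) (pr i) a := (pr i).hasFDerivAt
      have h3 : HasDerivAt (fun r : ℝ => r * y i / v i - r ^ 2 / (2 * v i))
          ((y i - a i) / v i) (a i) := by
        have h4 := (((hasDerivAt_id (a i)).mul_const (y i)).div_const (v i : ℝ)).sub
          ((hasDerivAt_pow 2 (a i)).div_const (2 * v i : ℝ))
        refine h4.congr_deriv ?_
        have := (hvpos i).ne'
        field_simp
        push_cast
        ring
      exact h3.comp_hasFDerivAt a h2
    refine (h1.exp.const_mul (ψ y)).congr_fderiv ?_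
    simp only [F', smul_smul]
  have hmain := hasFDerivAt_integral_of_dominated_of_fderiv_le (μ := γ) (F := F) (F' := F')
    (x₀ := 0) (bound := bd) (Metric.ball_mem_nhds 0 one_pos)
    (Eventually.of_forall hFm) hF0 hF'm (Eventually.of_forall hle) hbd
    (Eventually.of_forall hderiv)
  have hF'0 : F' 0 = fun y => ψ y • ∑ i, (y i / v i) • pr i := by
    ext1 y
    simp [F', q]
  have hint : Integrable (F' 0) γ :=
    hbd.mono' hF'm (Eventually.of_forall fun y => hle y 0 (Metric.mem_ball_self one_pos))
  rw [hF'0] at hint hmain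
  refine ⟨hint, hmain.congr_of_eventuallyEq (Eventually.of_forall fun a => ?_)⟩
  exact integral_add_pi_gaussianReal hv a hψ

end GaussianShift

/-! ### Diagonal operators -/

section Diagonal

variable {N : ℕ} (e : OrthonormalBasis (Fin N) ℝ (EuclideanSpace ℝ (Fin N)))
  {T : EuclideanSpace ℝ (Fin N) →L[ℝ] EuclideanSpace ℝ (Fin N)} {c : Fin N → ℝ}

lemma apply_eq_sum_of_diagonal (hT : ∀ n, T (e n) = c n • e n) (z : EuclideanSpace ℝ (Fin N)) :
    T z = ∑ n, (c n * inner ℝ (e n) z) • e n := by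
  conv_lhs => rw [← e.sum_repr' z, map_sum]
  refine Finset.sum_congr rfl fun n _ => ?_
  rw [map_smul, hT, smul_smul, mul_comm]

lemma inner_sum_smul_orthonormalBasis (a : Fin N → ℝ) (n : Fin N) :
    inner ℝ (e n) (∑ k, a k • e k) = a n := by
  simp [inner_sum, inner_smul_right, e.inner_eq_ite]

lemma inner_apply_of_diagonal (hT : ∀ n, T (e n) = c n • e n) (z : EuclideanSpace ℝ (Fin N))
    (n : Fin N) : inner ℝ (e n) (T z) = c n * inner ℝ (e n) z := by
  rw [apply_eq_sum_of_diagonal e hT, inner_sum_smul_orthonormalBasis]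

lemma exp_apply_of_eigenvector {F : Type*} [NormedAddCommGroup F] [NormedSpace ℝ F]
    [CompleteSpace F] {T : F →L[ℝ] F} {x : F} {μ : ℝ} (h : T x = μ • x) :
    NormedSpace.exp T x = Real.exp μ • x := by
  have hpow : ∀ k : ℕ, (T ^ k) x = μ ^ k • x := fun k => by
    induction k with
    | zero => simp
    | succ k ih => rw [pow_succ, mul_apply_eq_comp, h, map_smul, ih, smul_smul, pow_succ,
        mul_comm]
  have h1 := (ContinuousLinearMap.apply ℝ F x).hasSum (NormedSpace.exp_series_hasSum_exp' (𝕂 := ℝ) T)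
  have h2 := (NormedSpace.exp_series_hasSum_exp' (𝕂 := ℝ) μ).smul_const x
  rw [← Real.exp_eq_exp_ℝ] at h2
  refine h1.unique (h2.congr_fun fun k => ?_)
  simp [hpow, smul_smul]

lemma toEuclideanCLM_symm_apply_of_diagonal (hT : ∀ n, T (e n) = c n • e n) (i j : Fin N) :
    (Matrix.toEuclideanCLM (n := Fin N) (𝕜 := ℝ)).symm T i j = ∑ n, c n * (e n i * e n j) := by
  have h : ∀ M : Matrix (Fin N) (Fin N) ℝ,
      (Matrix.toEuclideanCLM (n := Fin N) (𝕜 := ℝ) M) (EuclideanSpace.single j 1) i = M i j :=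
    fun M => by simp
  refine (h _).symm.trans ?_
  rw [StarAlgEquiv.apply_symm_apply, apply_eq_sum_of_diagonal e hT]
  simp [EuclideanSpace.inner_single_right, mul_comm, mul_left_comm]

lemma exp_smul_apply_of_diagonal (hT : ∀ n, T (e n) = c n • e n) (r : ℝ) (n : Fin N) :
    NormedSpace.exp (r • T) (e n) = Real.exp (r * c n) • e n :=
  exp_apply_of_eigenvector (by rw [smul_apply, hT, smul_smul])

/-- The covariance matrix in terms of the eigenvalues. -/
lemma ouCovariance_apply {A Q : EuclideanSpace ℝ (Fin N) →L[ℝ] EuclideanSpace ℝ (Fin N)}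
    {lam σ : Fin N → ℝ} (hA : ∀ n, A (e n) = (-lam n) • e n)
    (hQ : ∀ n, Q (e n) = (σ n ^ 2) • e n) (ℓ : TimeChange) (t : ℝ≥0) (i j : Fin N) :
    ouCovariance A Q ℓ t i j = ∑ n, σ n ^ 2 *
      ℓ.integral (fun s => Real.exp (-2 * lam n * ((t : ℝ) - s))) t * (e n i * e n j) := by
  have hdiag : ∀ (s : ℝ≥0) (n : Fin N),
      (NormedSpace.exp ((2 * ((t : ℝ) - s)) • A) * Q) (e n) =
        (σ n ^ 2 * Real.exp (-2 * lam n * ((t : ℝ) - s))) • e n := fun s n => by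
    rw [mul_apply_eq_comp, hQ, map_smul, exp_smul_apply_of_diagonal e hA, smul_smul]
    congr 3
    ring
  rw [ouCovariance, Matrix.of_apply]
  simp_rw [fun s => toEuclideanCLM_symm_apply_of_diagonal e (hdiag s), TimeChange.integral]
  rw [integral_finsetSum]
  · refine Finset.sum_congr rfl fun n _ => ?_
    rw [integral_mul_const, integral_const_mul]
  · exact fun n _ => ℓ.integrableOn_of_continuous (by fun_prop) t

/-- The quadratic form gives positive semidefiniteness and is also the exponent to match in the
Gaussian characteristic function. -/
lemma dotProduct_ouCovariance_mulVec
    {A Q : EuclideanSpace ℝ (Fin N) →L[ℝ] EuclideanSpace ℝ (Fin N)}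
    {lam σ : Fin N → ℝ} (hA : ∀ n, A (e n) = (-lam n) • e n)
    (hQ : ∀ n, Q (e n) = (σ n ^ 2) • e n) (ℓ : TimeChange) (t : ℝ≥0) (x : Fin N → ℝ) :
    x ⬝ᵥ (ouCovariance A Q ℓ t).mulVec x = ∑ n, σ n ^ 2 *
      ℓ.integral (fun s => Real.exp (-2 * lam n * ((t : ℝ) - s))) t *
        (inner ℝ (e n) (WithLp.toLp 2 x)) ^ 2 := by
  have hinner : ∀ n, inner ℝ (e n) (WithLp.toLp 2 x) = ∑ i, e n i * x i := fun n => by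
    simp [PiLp.inner_apply, mul_comm]
  simp_rw [hinner, dotProduct, Matrix.mulVec, dotProduct, ouCovariance_apply e hA hQ, sq,
    Finset.sum_mul_sum, Finset.mul_sum, Finset.sum_mul, Finset.mul_sum]
  rw [Finset.sum_comm_cycle]
  refine Finset.sum_congr rfl fun n _ => Finset.sum_congr rfl fun i _ =>
    Finset.sum_congr rfl fun j _ => ?_
  ring

lemma posSemidef_ouCovariance {A Q : EuclideanSpace ℝ (Fin N) →L[ℝ] EuclideanSpace ℝ (Fin N)}
    {lam σ : Fin N → ℝ} (hA : ∀ n, A (e n) = (-lam n) • e n)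
    (hQ : ∀ n, Q (e n) = (σ n ^ 2) • e n) (ℓ : TimeChange) (t : ℝ≥0) :
    (ouCovariance A Q ℓ t).PosSemidef := by
  refine Matrix.PosSemidef.of_dotProduct_mulVec_nonneg ?_ fun x => ?_
  · ext i j
    simp [Matrix.conjTranspose_apply, ouCovariance_apply e hA hQ, mul_comm (e _ i)]
  · rw [star_trivial, dotProduct_ouCovariance_mulVec e hA hQ]
    exact Finset.sum_nonneg fun n _ => mul_nonneg (mul_nonneg (sq_nonneg _)
      (ℓ.integral_exp_nonneg _ _)) (sq_nonneg _)

/-- An affine image of a centred Gaussian product measure. -/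
lemma map_pi_gaussianReal_eq_multivariateGaussian {S : Matrix (Fin N) (Fin N) ℝ}
    (hS : S.PosSemidef) (μ : EuclideanSpace ℝ (Fin N)) (σ : Fin N → ℝ) (v : Fin N → ℝ≥0)
    (hSv : ∀ x : EuclideanSpace ℝ (Fin N),
      x.ofLp ⬝ᵥ S.mulVec x.ofLp = ∑ n, σ n ^ 2 * v n * (inner ℝ (e n) x) ^ 2) :
    (Measure.pi fun n => gaussianReal 0 (v n)).map (fun y => μ + ∑ n, (σ n * y n) • e n) =
      multivariateGaussian μ S := by
  have hm : Measurable fun y : Fin N → ℝ => μ + ∑ n, (σ n * y n) • e n := by fun_prop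
  have : IsProbabilityMeasure ((Measure.pi fun n => gaussianReal 0 (v n)).map
    (fun y => μ + ∑ n, (σ n * y n) • e n)) := Measure.isProbabilityMeasure_map hm.aemeasurable
  refine Measure.ext_of_charFun (funext fun x => ?_)
  rw [charFun_multivariateGaussian hS, charFun_apply, integral_map hm.aemeasurable (by fun_prop)]
  have hexp : ∀ y : Fin N → ℝ,
      Complex.exp (inner ℝ (μ + ∑ n, (σ n * y n) • e n) x * Complex.I) =
      Complex.exp (inner ℝ x μ * Complex.I) *
        ∏ n, Complex.exp ((σ n * inner ℝ (e n) x : ℝ) * y n * Complex.I) := fun y => by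
    rw [← Complex.exp_sum, ← Complex.exp_add]
    congr 1
    simp only [inner_add_left, sum_inner, real_inner_smul_left]
    rw [real_inner_comm x μ]
    push_cast
    rw [add_mul, Finset.sum_mul]
    congr 1
    exact Finset.sum_congr rfl fun n _ => by ring
  simp_rw [hexp]
  rw [integral_const_mul, integral_fintype_prod_eq_prod
    (f := fun n (y : ℝ) => Complex.exp ((σ n * inner ℝ (e n) x : ℝ) * y * Complex.I))]
  simp_rw [← charFun_apply_real, charFun_gaussianReal]
  rw [← Complex.exp_sum, ← Complex.exp_add, hSv]
  congr 1
  push_cast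
  rw [sub_eq_add_neg, Finset.sum_div, ← Finset.sum_neg_distrib]
  congr 1
  exact Finset.sum_congr rfl fun n _ => by ring

end Diagonal

/-! ### Solutions of the equation, path by path -/

/-- `ouPath` is linear in `(x, g)`; this separates the deterministic flow from `σ` times the
stochastic integral. -/
lemma ouPath_const_mul (lam x c : ℝ) (g : ℝ≥0 → ℝ) (t : ℝ≥0) :
    ouPath lam x (fun s => c * g s) t = Real.exp (-lam * t) * x + c * ouPath lam 0 g t := by
  have : ∀ s : ℝ, Real.exp (lam * s) * (c * g s.toNNReal) =
      c * (Real.exp (lam * s) * g s.toNNReal) := fun s => by ring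
  simp_rw [ouPath, this]
  rw [intervalIntegral.integral_const_mul]
  ring

section Paths

variable {N : ℕ} (e : OrthonormalBasis (Fin N) ℝ (EuclideanSpace ℝ (Fin N))) {lam σ : Fin N → ℝ}
  {A S : EuclideanSpace ℝ (Fin N) →L[ℝ] EuclideanSpace ℝ (Fin N)}
  {y : Fin N → ℝ≥0 → ℝ}

lemma apply_sum_smul_sub (hS : ∀ n, S (e n) = σ n • e n) (t : ℝ≥0) :
    S (∑ n, y n t • e n - ∑ n, y n 0 • e n) = ∑ n, (σ n * (y n t - y n 0)) • e n := by
  rw [← Finset.sum_sub_distrib, map_sum]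
  refine Finset.sum_congr rfl fun n _ => ?_
  rw [← sub_smul, map_smul, hS, smul_smul, mul_comm]

/-- Variation of constants for a solution path. -/
lemma eq_exp_add_sum_of_forall_eq (hA : ∀ n, A (e n) = (-lam n) • e n)
    (hS : ∀ n, S (e n) = σ n • e n) (hy : ∀ n, IsCadlag (y n))
    {x : EuclideanSpace ℝ (Fin N)}
    {X : ℝ≥0 → EuclideanSpace ℝ (Fin N)} (hX : IsCadlag X)
    (h : ∀ t : ℝ≥0, X t = x + (∫ s in (0 : ℝ)..t, A (X s.toNNReal)) +
      S (∑ n, y n t • e n - ∑ n, y n 0 • e n)) (t : ℝ≥0) :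
    X t = NormedSpace.exp ((t : ℝ) • A) x +
      ∑ n, (σ n * ouPath (lam n) 0 (fun s => y n s - y n 0) t) • e n := by
  -- Pairing the equation with an eigenvector gives the scalar equation, to which uniqueness
  -- applies.
  have hcoord : ∀ n, inner ℝ (e n) (X t) = Real.exp (-lam n * t) * inner ℝ (e n) x +
      σ n * ouPath (lam n) 0 (fun s => y n s - y n 0) t := fun n => by
    rw [← ouPath_const_mul]
    refine eq_ouPath_of_forall_eq ((hy n).comp_continuous (g := fun r => σ n * (r - y n 0))
      (by fun_prop)) (z := fun t => inner ℝ (e n) (X t))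
      (hX.comp_continuous (g := fun z => inner ℝ (e n) z) (by fun_prop)) (fun s => ?_) t
    rw [h s, inner_add_right, inner_add_right, apply_sum_smul_sub e hS,
      inner_sum_smul_orthonormalBasis]
    congr 2
    have hint := (hX.comp_continuous A.continuous).intervalIntegrable 0 (s : ℝ)
    have := (innerSL ℝ (e n)).intervalIntegral_comp_comm hint
    simp only [innerSL_apply_apply] at this
    rw [← this]
    simp_rw [inner_apply_of_diagonal e hA]
  rw [← e.sum_repr' (X t), apply_eq_sum_of_diagonal e
    (fun n => exp_smul_apply_of_diagonal e hA (t : ℝ) n) x, ← Finset.sum_add_distrib]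
  refine Finset.sum_congr rfl fun n _ => ?_
  rw [hcoord, ← add_smul]
  congr 4
  ring

lemma isCadlag_and_forall_sum_ouPath_eq (hA : ∀ n, A (e n) = (-lam n) • e n)
    (hS : ∀ n, S (e n) = σ n • e n) (hy : ∀ n, IsCadlag (y n))
    (x : EuclideanSpace ℝ (Fin N)) :
    IsCadlag (fun t => ∑ n, ouPath (lam n) (inner ℝ (e n) x)
        (fun s => σ n * (y n s - y n 0)) t • e n) ∧
    ∀ t : ℝ≥0, ∑ n, ouPath (lam n) (inner ℝ (e n) x) (fun s => σ n * (y n s - y n 0)) t • e n =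
      x + (∫ s in (0 : ℝ)..t, A (∑ n, ouPath (lam n) (inner ℝ (e n) x)
        (fun s => σ n * (y n s - y n 0)) s.toNNReal • e n)) +
      S (∑ n, y n t • e n - ∑ n, y n 0 • e n) := by
  have hg : ∀ n, IsCadlag fun s => σ n * (y n s - y n 0) := fun n =>
    (hy n).comp_continuous (g := fun r => σ n * (r - y n 0)) (by fun_prop)
  have hz := fun n => (hg n).ouPath (lam n) (inner ℝ (e n) x)
  have hsm : ∀ n, IsCadlag fun t => ouPath (lam n) (inner ℝ (e n) x)
      (fun s => σ n * (y n s - y n 0)) t • e n := fun n =>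
    (hz n).comp_continuous (g := fun r : ℝ => r • e n) (by fun_prop)
  refine ⟨IsCadlag.sum _ fun n _ => hsm n, fun t => ?_⟩
  have hAX : ∀ s : ℝ, A (∑ n, ouPath (lam n) (inner ℝ (e n) x)
      (fun s => σ n * (y n s - y n 0)) s.toNNReal • e n) =
      ∑ n, (-lam n * ouPath (lam n) (inner ℝ (e n) x)
        (fun s => σ n * (y n s - y n 0)) s.toNNReal) • e n := fun s => by
    rw [map_sum]
    exact Finset.sum_congr rfl fun n _ => by rw [map_smul, hA, smul_smul, mul_comm]
  simp_rw [hAX]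
  have hint := fun n => ((hz n).intervalIntegrable 0 (t : ℝ)).const_mul (-lam n)
  rw [intervalIntegral.integral_finsetSum fun n _ =>
    ⟨(hint n).1.smul_const (e n), (hint n).2.smul_const (e n)⟩]
  simp_rw [intervalIntegral.integral_smul_const]
  rw [apply_sum_smul_sub e hS]
  conv_rhs => enter [1, 1]; rw [← e.sum_repr' x]
  rw [← Finset.sum_add_distrib, ← Finset.sum_add_distrib]
  refine Finset.sum_congr rfl fun n _ => ?_
  rw [← add_smul, ← add_smul, ouPath_eq (hg n)]

end Paths

/-! ### Differentiability in the starting point -/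

/-- Differentiation of `x ↦ E φ(e^{tA} x + ∑ n, σ n * J n • e n)` for independent nondegenerate
centred Gaussian variables `J n`. -/
lemma hasFDerivAt_integral_gaussian_shift {N : ℕ}
    (e : OrthonormalBasis (Fin N) ℝ (EuclideanSpace ℝ (Fin N)))
    {T : EuclideanSpace ℝ (Fin N) →L[ℝ] EuclideanSpace ℝ (Fin N)} {d σ : Fin N → ℝ}
    (hT : ∀ n, T (e n) = d n • e n) (hσ : ∀ n, 0 < σ n) {v : Fin N → ℝ≥0} (hv : ∀ n, v n ≠ 0)
    {φ : EuclideanSpace ℝ (Fin N) → ℝ} (hφ : Measurable φ) {C : ℝ} (hC : ∀ y, |φ y| ≤ C)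
    (x : EuclideanSpace ℝ (Fin N)) :
    ∃ L : EuclideanSpace ℝ (Fin N) →L[ℝ] ℝ,
      HasFDerivAt (fun z => ∫ y, φ (T z + ∑ n, (σ n * y n) • e n)
        ∂(Measure.pi fun n => gaussianReal 0 (v n))) L x ∧
      ∀ h, Integrable (fun y : Fin N → ℝ => φ (T x + ∑ n, (σ n * y n) • e n) *
          ∑ n, 1 / σ n * (d n * inner ℝ h (e n) / v n) * y n)
          (Measure.pi fun n => gaussianReal 0 (v n)) ∧
        L h = ∫ y, φ (T x + ∑ n, (σ n * y n) • e n) *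
          ∑ n, 1 / σ n * (d n * inner ℝ h (e n) / v n) * y n
          ∂(Measure.pi fun n => gaussianReal 0 (v n)) := by
  let ψ : (Fin N → ℝ) → ℝ := fun y => φ (T x + ∑ n, (σ n * y n) • e n)
  have hψ : Measurable ψ := hφ.comp (by fun_prop)
  obtain ⟨hint, hderiv⟩ := hasFDerivAt_integral_add_pi_gaussianReal hv hψ (C := C) fun y => hC _
  -- Chosen so that `T h = ∑ n, (σ n * b h n) • e n`; dividing by `σ n` is where nondegenerate noise
  -- enters.
  let b : EuclideanSpace ℝ (Fin N) →L[ℝ] (Fin N → ℝ) :=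
    ContinuousLinearMap.pi fun n => (1 / σ n * d n) • innerSL ℝ (e n)
  have hb : ∀ h n, b h n = 1 / σ n * d n * inner ℝ (e n) h := fun h n => by simp [b]
  have hshift : ∀ z (y : Fin N → ℝ), ψ (b (z - x) + y) = φ (T z + ∑ n, (σ n * y n) • e n) :=
    fun z y => by
    simp only [ψ]
    congr 1
    have h1 : T z = T x + T (z - x) := by rw [← map_add]; congr 1; abel
    rw [h1, apply_eq_sum_of_diagonal e hT (z - x), add_assoc, ← Finset.sum_add_distrib]
    congr 1
    refine Finset.sum_congr rfl fun n _ => ?_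
    rw [← add_smul, Pi.add_apply, hb]
    congr 1
    have := (hσ n).ne'
    field_simp
  have hb0 : b (x - x) = 0 := by simp
  have hcomp := (hb0 ▸ hderiv).comp x (b.hasFDerivAt.comp x ((hasFDerivAt_id x).sub_const x))
  have happly : ∀ h (y : Fin N → ℝ), (ψ y • ∑ i, (y i / v i) • ContinuousLinearMap.proj (R := ℝ)
        (φ := fun _ : Fin N => ℝ) i) (b h) = φ (T x + ∑ n, (σ n * y n) • e n) *
          ∑ n, 1 / σ n * (d n * inner ℝ h (e n) / v n) * y n := fun h y => by
    simp only [smul_apply, sum_apply,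
      ContinuousLinearMap.proj_apply, smul_eq_mul, hb, ψ]
    congr 1
    refine Finset.sum_congr rfl fun n _ => ?_
    rw [real_inner_comm]
    ring
  refine ⟨_, hcomp.congr_of_eventuallyEq (Eventually.of_forall fun z => ?_), fun h => ⟨?_, ?_⟩⟩
  · simp only [Function.comp, id, hshift]
  · refine (((ContinuousLinearMap.apply ℝ ℝ (b h)).integrable_comp hint)).congr
      (Eventually.of_forall fun y => ?_)
    exact happly h y
  · have h1 := ContinuousLinearMap.integral_apply hint (b h)
    simp only [happly] at h1
    rw [← h1]
    rfl

theorem mainTheorem4 {Ω : Type*} [MeasurableSpace Ω] (P : Measure Ω) [IsProbabilityMeasure P]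
    (N : ℕ) (e : OrthonormalBasis (Fin N) ℝ (EuclideanSpace ℝ (Fin N)))
    -- `A`, `Q` and the nonnegative root of `Q`, given by their eigenvalues on the common basis `e`
    (lam σ : Fin N → ℝ) (hlam : ∀ n, 0 < lam n) (hσ : ∀ n, 0 ≤ σ n)
    (A Q sqrtQ : EuclideanSpace ℝ (Fin N) →L[ℝ] EuclideanSpace ℝ (Fin N))
    (hA : ∀ n, A (e n) = (-lam n) • e n) (hQ : ∀ n, Q (e n) = (σ n ^ 2) • e n)
    (hsqrtQ : ∀ n, sqrtQ (e n) = σ n • e n)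
    -- independent Brownian motions, and `W = ∑ n, β n • e n`
    (β : Fin N → ℝ≥0 → Ω → ℝ) (hβ_meas : ∀ n t, Measurable (β n t))
    (hβ : ∀ n, IsBrownianReal (β n) P)
    (hβ_indep : iIndepFun (fun n ω => fun t : ℝ≥0 => β n t ω) P)
    (W : ℝ≥0 → Ω → EuclideanSpace ℝ (Fin N)) (hW : ∀ t ω, W t ω = ∑ n, β n t ω • e n)
    (ℓ : TimeChange)
    -- `I n t = ∫_0^t e^{-lam n (t - s)} dβ^n_{ℓ_s}`
    (I : Fin N → ℝ≥0 → Ω → ℝ)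
    (hI : ∀ n (t : ℝ≥0), I n t = stochIntegral P (fun s => Real.exp (-lam n * ((t : ℝ) - s)))
      (fun s => β n (ℓ s)) t) :
    -- the SDE has a solution for every starting point, unique up to indistinguishability
    (∀ x, ∃ X, IsOUSolution P A sqrtQ (fun t => W (ℓ t)) x X) ∧
    (∀ x X X', IsOUSolution P A sqrtQ (fun t => W (ℓ t)) x X →
      IsOUSolution P A sqrtQ (fun t => W (ℓ t)) x X' → ∀ᵐ ω ∂P, ∀ t, X t ω = X' t ω) ∧
    -- the stochastic integrals exist
    (∀ n (t : ℝ≥0), IsStochIntegral P (fun s => Real.exp (-lam n * ((t : ℝ) - s)))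
      (fun s => β n (ℓ s)) t (I n t)) ∧
    ∀ Z : EuclideanSpace ℝ (Fin N) → ℝ≥0 → Ω → EuclideanSpace ℝ (Fin N),
      (∀ x, IsOUSolution P A sqrtQ (fun t => W (ℓ t)) x (Z x)) →
      -- variation of constants
      (∀ x t, ∀ᵐ ω ∂P, Z x t ω = NormedSpace.exp ((t : ℝ) • A) x + ∑ n, (σ n * I n t ω) • e n) ∧
      -- the law of the solution
      (∀ x t, HasLaw (Z x t)
        (multivariateGaussian (NormedSpace.exp ((t : ℝ) • A) x) (ouCovariance A Q ℓ t)) P) ∧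
      -- smoothing and the derivative formula
      ((∀ n, 0 < σ n) → ∀ t : ℝ≥0, 0 < t → ∀ φ : EuclideanSpace ℝ (Fin N) → ℝ,
        Measurable φ → (∃ C : ℝ, ∀ y, |φ y| ≤ C) → ∀ x,
          DifferentiableAt ℝ (fun y => ∫ ω, φ (Z y t ω) ∂P) x ∧
          ∀ h : EuclideanSpace ℝ (Fin N),
            Integrable (fun ω => φ (Z x t ω) * ∑ n, 1 / σ n *
              (Real.exp (-lam n * t) * inner ℝ h (e n) /
                ℓ.integral (fun s => Real.exp (-2 * lam n * ((t : ℝ) - s))) t) * I n t ω) P ∧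
            inner ℝ (gradient (fun y => ∫ ω, φ (Z y t ω) ∂P) x) h =
              ∫ ω, φ (Z x t ω) * ∑ n, 1 / σ n *
                (Real.exp (-lam n * t) * inner ℝ h (e n) /
                  ℓ.integral (fun s => Real.exp (-2 * lam n * ((t : ℝ) - s))) t) * I n t ω ∂P) := by
  have hcadβ : ∀ᵐ ω ∂P, ∀ n, IsCadlag fun s => β n (ℓ s) ω :=
    ae_all_iff.2 fun n => (hβ n).ae_isCadlag_timeChange ℓ
  have hJ : ∀ n (t : ℝ≥0), IsStochIntegral P (fun s => Real.exp (-lam n * ((t : ℝ) - s)))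
      (fun s => β n (ℓ s)) t
      (fun ω => ouPath (lam n) 0 (fun s => β n (ℓ s) ω - β n (ℓ 0) ω) t) := fun n t =>
    isStochIntegral_ouPath (Y := fun s => β n (ℓ s)) (fun s => hβ_meas n (ℓ s))
      ((hβ n).ae_isCadlag_timeChange ℓ) (lam n) t
  have hIint : ∀ n (t : ℝ≥0), IsStochIntegral P (fun s => Real.exp (-lam n * ((t : ℝ) - s)))
      (fun s => β n (ℓ s)) t (I n t) := fun n t => by
    rw [hI n t]
    exact (hJ n t).isStochIntegral_stochIntegral
  have hIJ : ∀ t : ℝ≥0, ∀ᵐ ω ∂P, ∀ n,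
      I n t ω = ouPath (lam n) 0 (fun s => β n (ℓ s) ω - β n (ℓ 0) ω) t := fun t =>
    ae_all_iff.2 fun n => (hIint n t).ae_eq (hJ n t)
  -- Stated with `ouPath` rather than `I`: the versions `I n t` agree with it almost surely only for
  -- each fixed `t`, whereas indistinguishability needs one null set for all `t`.
  have hformula : ∀ x X, IsOUSolution P A sqrtQ (fun t => W (ℓ t)) x X → ∀ᵐ ω ∂P, ∀ t : ℝ≥0,
      X t ω = NormedSpace.exp ((t : ℝ) • A) x + ∑ n, (σ n *
        ouPath (lam n) 0 (fun s => β n (ℓ s) ω - β n (ℓ 0) ω) t) • e n := fun x X hX => by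
    filter_upwards [hX, hcadβ] with ω hω hωβ t
    simp only [hW] at hω
    exact eq_exp_add_sum_of_forall_eq e hA hsqrtQ hωβ hω.1 hω.2 t
  have hlaw : ∀ t : ℝ≥0, HasLaw (fun ω n => I n t ω) (Measure.pi fun n => gaussianReal 0
      (ℓ.integral (fun s => Real.exp (-2 * lam n * ((t : ℝ) - s))) t).toNNReal) P := fun t => by
    refine (hasLaw_pi_ouPath hβ hβ_indep ℓ lam t).congr ?_
    filter_upwards [hIJ t] with ω hω using funext hω
  refine ⟨fun x => ?_, fun x X X' hX hX' => ?_, hIint, fun Z hZ => ?_⟩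
  · refine ⟨fun t ω => ∑ n, ouPath (lam n) (inner ℝ (e n) x)
      (fun s => σ n * (β n (ℓ s) ω - β n (ℓ 0) ω)) t • e n, ?_⟩
    filter_upwards [hcadβ] with ω hω
    simp only [hW]
    exact isCadlag_and_forall_sum_ouPath_eq e hA hsqrtQ hω x
  · filter_upwards [hformula x X hX, hformula x X' hX'] with ω h h' t
    rw [h, h']
  have hvar : ∀ x t, ∀ᵐ ω ∂P,
      Z x t ω = NormedSpace.exp ((t : ℝ) • A) x + ∑ n, (σ n * I n t ω) • e n := fun x t => by
    filter_upwards [hformula x (Z x) (hZ x), hIJ t] with ω h hω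
    simp only [hω, h]
  refine ⟨hvar, fun x t => ?_, fun hσpos t ht φ hφ ⟨C, hC⟩ x => ?_⟩
  · refine HasLaw.congr ?_ (hvar x t)
    refine HasLaw.comp (Y := fun y : Fin N → ℝ =>
      NormedSpace.exp ((t : ℝ) • A) x + ∑ n, (σ n * y n) • e n)
      (μ := Measure.pi fun n => gaussianReal 0
        (ℓ.integral (fun s => Real.exp (-2 * lam n * ((t : ℝ) - s))) t).toNNReal)
      ⟨Measurable.aemeasurable (by fun_prop), ?_⟩ (hlaw t)
    refine map_pi_gaussianReal_eq_multivariateGaussian e (posSemidef_ouCovariance e hA hQ ℓ t)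
      _ σ _ fun z => ?_
    rw [dotProduct_ouCovariance_mulVec e hA hQ]
    simp only [Real.coe_toNNReal _ (ℓ.integral_exp_nonneg _ _)]
  · have hvpos := fun n => ℓ.integral_exp_pos (lam n) ht
    have hdiag : ∀ n, NormedSpace.exp ((t : ℝ) • A) (e n) = Real.exp (-lam n * t) • e n :=
      fun n => by
      rw [exp_smul_apply_of_diagonal e hA]
      congr 2
      ring
    obtain ⟨L, hL, hLh⟩ := hasFDerivAt_integral_gaussian_shift e hdiag hσpos
      (v := fun n => (ℓ.integral (fun s => Real.exp (-2 * lam n * ((t : ℝ) - s))) t).toNNReal)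
      (fun n => (Real.toNNReal_pos.2 (hvpos n)).ne') hφ hC x
    simp only [Real.coe_toNNReal _ (ℓ.integral_exp_nonneg _ _)] at hLh
    -- The expectation depends only on the joint law of the integrals, so differentiation takes
    -- place under a fixed Gaussian product measure. The identity is needed for all `z`, not just at
    -- `x`.
    have hF : (fun z => ∫ ω, φ (Z z t ω) ∂P) = fun z => ∫ y,
        φ (NormedSpace.exp ((t : ℝ) • A) z + ∑ n, (σ n * y n) • e n)
        ∂(Measure.pi fun n => gaussianReal 0
          (ℓ.integral (fun s => Real.exp (-2 * lam n * ((t : ℝ) - s))) t).toNNReal) := by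
      ext z
      rw [← (hlaw t).integral_comp (f := fun y : Fin N → ℝ =>
        φ (NormedSpace.exp ((t : ℝ) • A) z + ∑ n, (σ n * y n) • e n))
        (hφ.comp (by fun_prop)).aestronglyMeasurable]
      refine integral_congr_ae ?_
      filter_upwards [hvar z t] with ω hω
      rw [hω]
      rfl
    have hae : ∀ h : EuclideanSpace ℝ (Fin N), (fun ω => φ (Z x t ω) * ∑ n, 1 / σ n *
        (Real.exp (-lam n * t) * inner ℝ h (e n) /
          ℓ.integral (fun s => Real.exp (-2 * lam n * ((t : ℝ) - s))) t) * I n t ω) =ᵐ[P]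
        (fun y : Fin N → ℝ => φ (NormedSpace.exp ((t : ℝ) • A) x + ∑ n, (σ n * y n) • e n) *
          ∑ n, 1 / σ n * (Real.exp (-lam n * t) * inner ℝ h (e n) /
          ℓ.integral (fun s => Real.exp (-2 * lam n * ((t : ℝ) - s))) t) * y n) ∘
          (fun ω n => I n t ω) := fun h => by
      filter_upwards [hvar x t] with ω hω
      rw [hω]
      rfl
    rw [hF]
    refine ⟨hL.differentiableAt, fun h => ⟨?_, ?_⟩⟩
    · refine Integrable.congr ?_ (hae h).symm
      refine Integrable.comp_aemeasurable ?_ (hlaw t).aemeasurable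
      rw [(hlaw t).map_eq]
      exact (hLh h).1
    · rw [inner_gradient_left, hL.fderiv, (hLh h).2, integral_congr_ae (hae h),
        (hlaw t).integral_comp (hLh h).1.aestronglyMeasurable]
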